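/- Let $f\in\mathbb{C}[x]=\mathbb{C}[x_1,\dots,x_n]$ be a non-zero polynomial, $D$ the $n$-th Weyl algebra over $\mathbb{C}$, $D[s]=D\otimes_{\mathbb{C}}\mathbb{C}[s]$, and, for $p\in\mathbb{C}^n$, let $D_p$ be the Weyl algebra with coefficients in the local ring $\mathbb{C}[x]_p$. The ring $D[s]$ acts on the free module $\mathbb{C}[x][s,1/f]\cdot f^s$ by $\partial_i(g f^s)=\big(\frac{\partial g}{\partial x_i}+s g\frac{\partial f}{\partial x_i}\frac1f\big)f^s$, and $D_p[s]$ acts in the same way on $\mathbb{C}[x]_p[s,1/f]\cdot f^s$. The global $b$-function $b_f(s)\in\mathbb{C}[s]$ (resp. the local $b$-function $b_{f,p}(s)$) is the monic polynomial $b(s)$ of minimal degree such that $P(s)f\cdot f^s=b(s)\cdot f^s$ for some $P(s)\in D[s]$ (resp. $P(s)\in D_p[s]$). For $\alpha\in\mathbb{C}$ let $m_\alpha$ and $m_\alpha(p)$ be the multiplicities of $\alpha$ as a root of $b_f(-s)$ and of $b_{f,p}(-s)$, that is, the exponents of $s+\alpha$ in $b_f(s)$ and in $b_{f,p}(s)$.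 Consider the left ideals of $D[s]$ $$I=\operatorname{ann}_{D[s]}(f^s)+D[s]\langle f\rangle,\qquad I_{\alpha,i}=\big(I:(s+\alpha)^i\big)+D[s]\langle s+\alpha\rangle ,$$ where $I:q=\{P\in D[s]: Pq\in I\}$, and the affine varieties $V_{\alpha,i}=V(I_{\alpha,i}\cap\mathbb{C}[x])\subseteq\mathbb{C}^n$. Then the polynomials $b_f$ and $b_{f,p}$ ($p\in\mathbb{C}^n$) exist, and for all $\alpha\in\mathbb{C}$, $i\ge 0$ and $p\in\mathbb{C}^n$ $$m_\alpha(p)>i\iff p\in V_{\alpha,i}.$$ Consequently, for every $\alpha$, $$\emptyset=V_{\alpha,m_\alpha}\subseteq V_{\alpha,m_\alpha-1}\subseteq\cdots\subseteq V_{\alpha,0}\subseteq V_{\alpha,-1}:=\mathbb{C}^n,$$ the inclusions $V_{\alpha,i+1}\subseteq V_{\alpha,i}$ hold for all $i\ge 0$, and $m_\alpha(p)=i$ if and only if $p\in V_{\alpha,i-1}\setminus V_{\alpha,i}$, for all $i\ge 0$. The varieties $V_{\alpha,i}$, for $-\alpha$ a root of $b_f(s)$ and $0\le i<m_\alpha$,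 stratify $\mathbb{C}^n$ by local $b$-functions: for $p,q\in\mathbb{C}^n$ one has $b_{f,p}=b_{f,q}$ if and only if $p$ and $q$ lie in the same ones of these varieties. -/

import Mathlib

namespace BernsteinSato

noncomputable section

open Polynomial

/-- A commutative `ℂ`-algebra with `n` commuting `ℂ`-derivations `∂₁, …, ∂ₙ`. It is only used for
`ℂ[x₁, …, xₙ]` and its localizations, with the partial derivatives. -/
class Partials (n : ℕ) (A : Type) [CommRing A] [Algebra ℂ A] where
  pd : Fin n → Derivation ℂ A A
  pd_comm : ∀ i j a, pd i (pd j a) = pd j (pd i a)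

/-- `ℂ[x₁, …, xₙ]` with the partial derivatives. -/
instance polyPartials (n : ℕ) : Partials n (MvPolynomial (Fin n) ℂ) where
  pd := MvPolynomial.pderiv
  pd_comm i j a := by
    have h : ⁅(MvPolynomial.pderiv i : Derivation ℂ (MvPolynomial (Fin n) ℂ) (MvPolynomial (Fin n) ℂ)),
        (MvPolynomial.pderiv j :
          Derivation ℂ (MvPolynomial (Fin n) ℂ) (MvPolynomial (Fin n) ℂ))⁆ = 0 := by
      apply MvPolynomial.derivation_ext
      intro k
      rw [Derivation.commutator_apply, MvPolynomial.pderiv_X, MvPolynomial.pderiv_X]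
      simp only [Pi.single_apply]
      split_ifs <;> simp
    have := congrArg (fun d => d a) h
    simpa [Derivation.commutator_apply, sub_eq_zero] using this

section Localization

variable {A : Type} [CommRing A] [Algebra ℂ A] (S : Submonoid A)

/-- The ring homomorphism `a ↦ a + d(a) ε` into the dual numbers over `S⁻¹A`. -/
def dualHom (d : Derivation ℂ A A) :
    A →+* TrivSqZeroExt (Localization S) (Localization S) where
  toFun a := (algebraMap A (Localization S) a, algebraMap A (Localization S) (d a))
  map_one' := by ext <;> simp
  map_zero' := by ext <;> simp
  map_add' a b := by
    ext
    · exact map_add _ a b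
    · change algebraMap A (Localization S) (d (a + b)) =
        algebraMap A (Localization S) (d a) + algebraMap A (Localization S) (d b)
      rw [map_add, map_add]
  map_mul' a b := by
    ext
    · exact map_mul _ a b
    · change algebraMap A (Localization S) (d (a * b)) =
        algebraMap A (Localization S) a * algebraMap A (Localization S) (d b) +
          algebraMap A (Localization S) (d a) * algebraMap A (Localization S) b
      rw [Derivation.leibniz, map_add, smul_eq_mul, smul_eq_mul, map_mul, map_mul]
      ring

theorem dualHom_fst (d : Derivation ℂ A A) (a : A) :
    (dualHom S d a).fst = algebraMap A (Localization S) a := rfl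

theorem dualHom_snd (d : Derivation ℂ A A) (a : A) :
    (dualHom S d a).snd = algebraMap A (Localization S) (d a) := rfl

theorem dualHom_isUnit (d : Derivation ℂ A A) (s : S) : IsUnit (dualHom S d s) :=
  TrivSqZeroExt.isUnit_iff_isUnit_fst.2 <| by
    rw [dualHom_fst]
    exact (IsLocalization.map_units (Localization S) s)

/-- The extension of `dualHom` to `S⁻¹A`. -/
def dualLift (d : Derivation ℂ A A) :
    Localization S →+* TrivSqZeroExt (Localization S) (Localization S) :=
  IsLocalization.lift (M := S) (dualHom_isUnit S d)

theorem dualLift_algebraMap (d : Derivation ℂ A A) (a : A) :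
    dualLift S d (algebraMap A (Localization S) a) = dualHom S d a :=
  IsLocalization.lift_eq _ _

theorem dualLift_fst (d : Derivation ℂ A A) (b : Localization S) : (dualLift S d b).fst = b := by
  have h : ((TrivSqZeroExt.fstHom (Localization S) (Localization S)
      (Localization S)).toRingHom.comp (dualLift S d)) = RingHom.id _ := by
    apply IsLocalization.ringHom_ext S
    ext a
    simp only [RingHom.comp_apply, dualLift_algebraMap]
    exact dualHom_fst S d a
  exact congrArg (fun g => g b) h

/-- The extension of a derivation of `A` to `S⁻¹A` (quotient rule). -/
def locDer (d : Derivation ℂ A A) : Derivation ℂ (Localization S) (Localization S) where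
  toFun b := (dualLift S d b).snd
  map_add' a b := by simp
  map_smul' c b := by
    have h : (dualLift S d (algebraMap ℂ (Localization S) c)).snd = 0 := by
      rw [IsScalarTower.algebraMap_apply ℂ A (Localization S), dualLift_algebraMap, dualHom_snd]
      simp
    rw [Algebra.smul_def, map_mul, TrivSqZeroExt.snd_mul, h, dualLift_fst, dualLift_fst]
    simp [Algebra.smul_def]
  map_one_eq_zero' := by simp
  leibniz' a b := by
    simp [TrivSqZeroExt.snd_mul, dualLift_fst, mul_comm]

theorem locDer_algebraMap (d : Derivation ℂ A A) (a : A) :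
    locDer S d (algebraMap A (Localization S) a) = algebraMap A (Localization S) (d a) := by
  change (dualLift S d (algebraMap A (Localization S) a)).snd = _
  rw [dualLift_algebraMap, dualHom_snd]

theorem loc_derivation_eq_zero (D : Derivation ℂ (Localization S) (Localization S))
    (h : ∀ a, D (algebraMap A (Localization S) a) = 0) (b : Localization S) : D b = 0 := by
  obtain ⟨⟨a, s⟩, hs⟩ := IsLocalization.surj S b
  have h1 := congrArg D hs
  rw [Derivation.leibniz, h, h, smul_zero, zero_add, smul_eq_mul] at h1
  exact (IsLocalization.map_units (Localization S) s).mul_right_eq_zero.1 h1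

/-- The partial derivatives on a localization. -/
instance locPartials (n : ℕ) [Partials n A] : Partials n (Localization S) where
  pd i := locDer S (Partials.pd i)
  pd_comm i j a := by
    have := loc_derivation_eq_zero S ⁅locDer S (Partials.pd (n := n) i), locDer S (Partials.pd j)⁆
      (fun a => by
        simp [Derivation.commutator_apply, locDer_algebraMap, Partials.pd_comm i j a]) a
    simpa [Derivation.commutator_apply, sub_eq_zero] using this

end Localization

section Weyl

variable (n : ℕ) (A : Type) [CommRing A] [Algebra ℂ A] [Partials n A]

/-- The defining relations of the Weyl algebra with coefficients in `A`: the coefficients form a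
copy of the `ℂ`-algebra `A`, `∂ᵢ a = a ∂ᵢ + ∂a/∂xᵢ`, and `∂ᵢ ∂ⱼ = ∂ⱼ ∂ᵢ`. -/
inductive WeylRel : FreeAlgebra ℂ (A ⊕ Fin n) → FreeAlgebra ℂ (A ⊕ Fin n) → Prop
  | scalar (c : ℂ) : WeylRel (FreeAlgebra.ι ℂ (Sum.inl (algebraMap ℂ A c))) (algebraMap ℂ _ c)
  | add (a b : A) : WeylRel (FreeAlgebra.ι ℂ (Sum.inl (a + b)))
      (FreeAlgebra.ι ℂ (Sum.inl a) + FreeAlgebra.ι ℂ (Sum.inl b))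
  | mul (a b : A) : WeylRel (FreeAlgebra.ι ℂ (Sum.inl (a * b)))
      (FreeAlgebra.ι ℂ (Sum.inl a) * FreeAlgebra.ι ℂ (Sum.inl b))
  | leibniz (i : Fin n) (a : A) :
      WeylRel (FreeAlgebra.ι ℂ (Sum.inr i) * FreeAlgebra.ι ℂ (Sum.inl a))
        (FreeAlgebra.ι ℂ (Sum.inl a) * FreeAlgebra.ι ℂ (Sum.inr i)
          + FreeAlgebra.ι ℂ (Sum.inl (Partials.pd i a)))
  | comm (i j : Fin n) :
      WeylRel (FreeAlgebra.ι ℂ (Sum.inr i) * FreeAlgebra.ι ℂ (Sum.inr j))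
        (FreeAlgebra.ι ℂ (Sum.inr j) * FreeAlgebra.ι ℂ (Sum.inr i))

/-- The Weyl algebra with coefficients in `A`: this is `Dₙ` for `A = ℂ[x₁, …, xₙ]` and the local
Weyl algebra `D_p` for `A = ℂ[x₁, …, xₙ]_p`. The ring `D[s]`, with `s` central, is
`(Weyl n A)[X]`. -/
abbrev Weyl : Type := RingQuot (WeylRel n A)

/-- A function, as an operator of order zero. -/
def Weyl.coef : A →+* Weyl n A where
  toFun a := RingQuot.mkAlgHom ℂ (WeylRel n A) (FreeAlgebra.ι ℂ (Sum.inl a))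
  map_one' := by
    have := RingQuot.mkAlgHom_rel ℂ (WeylRel.scalar (n := n) (A := A) 1)
    simpa using this
  map_zero' := by
    have := RingQuot.mkAlgHom_rel ℂ (WeylRel.scalar (n := n) (A := A) 0)
    simpa using this
  map_add' a b := by
    have := RingQuot.mkAlgHom_rel ℂ (WeylRel.add (n := n) (A := A) a b)
    simpa using this
  map_mul' a b := by
    have := RingQuot.mkAlgHom_rel ℂ (WeylRel.mul (n := n) (A := A) a b)
    simpa using this

/-- A function, as an element of `D[s]`. -/
def coefS : A →+* (Weyl n A)[X] := (C : Weyl n A →+* (Weyl n A)[X]).comp (Weyl.coef n A)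

variable {A}

/-- The module `A[s, 1/f] · f^s`, free of rank one over `A[s, 1/f]`; the element `g` of the type
stands for `g · f^s`, and the polynomial variable is `s`. -/
abbrev PowModule (f : A) : Type := (Localization.Away f)[X]

/-- The generator `f^s`. -/
def fs (f : A) : PowModule f := 1

/-- A derivation of `B` acting on the coefficients of `B[s]`. -/
def coeffDer {B : Type} [CommRing B] [Algebra ℂ B] (d : Derivation ℂ B B) :
    Derivation ℂ B[X] B[X] :=
  PolynomialModule.equivPolynomialSelf.compDer d.mapCoeffs

theorem coeff_coeffDer {B : Type} [CommRing B] [Algebra ℂ B] (d : Derivation ℂ B B) (p : B[X])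
    (k : ℕ) : (coeffDer d p).coeff k = d (p.coeff k) := rfl

theorem coeffDer_C {B : Type} [CommRing B] [Algebra ℂ B] (d : Derivation ℂ B B) (b : B) :
    coeffDer d (C b) = C (d b) := by
  ext k
  rw [coeff_coeffDer, coeff_C, coeff_C]
  split_ifs <;> simp

theorem coeffDer_X {B : Type} [CommRing B] [Algebra ℂ B] (d : Derivation ℂ B B) :
    coeffDer d X = 0 := by
  ext k
  rw [coeff_coeffDer, coeff_X]
  split_ifs <;> simp

/-- The element `s · (∂f/∂xᵢ) · (1/f)` of `A[s, 1/f]`. -/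
def logTerm (f : A) (i : Fin n) : (Localization.Away f)[X] :=
  X * C (algebraMap A (Localization.Away f) (Partials.pd i f) *
    IsLocalization.Away.invSelf (S := Localization.Away f) f)

/-- The action `∂ᵢ (g · f^s) = (∂g/∂xᵢ + s g (∂f/∂xᵢ) / f) · f^s`. -/
def pdAct (f : A) (i : Fin n) : Module.End ℂ (PowModule f) :=
  (coeffDer (Partials.pd i : Derivation ℂ (Localization.Away f) (Localization.Away f)) :
    PowModule f →ₗ[ℂ] PowModule f) + LinearMap.mulLeft ℂ (logTerm n f i)

theorem pdAct_apply (f : A) (i : Fin n) (g : PowModule f) :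
    pdAct n f i g = coeffDer (Partials.pd i) g + logTerm n f i * g := rfl

theorem pd_logTerm_comm (f : A) (i j : Fin n) :
    coeffDer (Partials.pd i) (logTerm n f j) = coeffDer (Partials.pd j) (logTerm n f i) := by
  have hinv : algebraMap A (Localization.Away f) f *
      IsLocalization.Away.invSelf (S := Localization.Away f) f = 1 :=
    IsLocalization.Away.mul_invSelf f
  have hpd : ∀ (k : Fin n) (a : A), (Partials.pd k : Derivation ℂ (Localization.Away f) _)
      (algebraMap A _ a) = algebraMap A _ (Partials.pd k a) :=
    fun k a => locDer_algebraMap _ _ a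
  set u := IsLocalization.Away.invSelf (S := Localization.Away f) f with hu
  have hdu : ∀ k : Fin n, (Partials.pd k : Derivation ℂ (Localization.Away f) _) u =
      - (u * u * algebraMap A _ (Partials.pd k f)) := by
    intro k
    have h := congrArg (Partials.pd k : Derivation ℂ (Localization.Away f) _) hinv
    rw [Derivation.leibniz, hpd, Derivation.map_one_eq_zero, smul_eq_mul, smul_eq_mul] at h
    linear_combination u * h - (Partials.pd k : Derivation ℂ (Localization.Away f) _) u * hinv
  simp only [logTerm, Derivation.leibniz, coeffDer_C, coeffDer_X, smul_eq_mul, mul_zero, add_zero,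
    ← hu]
  congr 2
  rw [hpd, hpd, hdu, hdu, Partials.pd_comm i j f]
  ring

/-- The action of the generators of the Weyl algebra on `A[s, 1/f] · f^s`. -/
def freeAct (f : A) : FreeAlgebra ℂ (A ⊕ Fin n) →ₐ[ℂ] Module.End ℂ (PowModule f) :=
  FreeAlgebra.lift ℂ (Sum.elim
    (fun a => LinearMap.mulLeft ℂ (C (algebraMap A (Localization.Away f) a))) (pdAct n f))

theorem freeAct_rel (f : A) ⦃x y : FreeAlgebra ℂ (A ⊕ Fin n)⦄ (h : WeylRel n A x y) :
    freeAct n f x = freeAct n f y := by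
  induction h with
  | scalar c =>
    ext1 g
    simp only [freeAct, FreeAlgebra.lift_ι_apply, Sum.elim_inl, AlgHom.commutes,
      LinearMap.mulLeft_apply, Module.algebraMap_end_apply]
    rw [← IsScalarTower.algebraMap_apply ℂ A (Localization.Away f), Algebra.smul_def]
    rfl
  | add a b => ext1 g; simp [freeAct, add_mul]
  | mul a b => ext1 g; simp [freeAct]
  | leibniz i a =>
    ext1 g
    have hpd : (Partials.pd i : Derivation ℂ (Localization.Away f) _)
        (algebraMap A _ a) = algebraMap A _ (Partials.pd i a) := locDer_algebraMap _ _ a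
    simp only [freeAct, map_mul, map_add, FreeAlgebra.lift_ι_apply, Sum.elim_inl, Sum.elim_inr,
      Module.End.mul_apply, LinearMap.mulLeft_apply, LinearMap.add_apply, pdAct_apply,
      Derivation.leibniz, coeffDer_C, smul_eq_mul, hpd]
    ring
  | comm i j =>
    ext1 g
    have h1 : coeffDer (Partials.pd i : Derivation ℂ (Localization.Away f) _)
        (coeffDer (Partials.pd j) g) = coeffDer (Partials.pd j) (coeffDer (Partials.pd i) g) := by
      ext k
      simp only [coeff_coeffDer]
      exact Partials.pd_comm i j _
    have h2 := pd_logTerm_comm n f i j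
    simp only [freeAct, map_mul, FreeAlgebra.lift_ι_apply, Sum.elim_inr,
      Module.End.mul_apply, pdAct_apply, Derivation.leibniz, smul_eq_mul, map_add]
    rw [h1]
    linear_combination g * h2

/-- The action of the Weyl algebra on `A[s, 1/f] · f^s`. -/
def weylAct (f : A) : Weyl n A →ₐ[ℂ] Module.End ℂ (PowModule f) :=
  RingQuot.liftAlgHom ℂ ⟨freeAct n f, freeAct_rel n f⟩

theorem weylAct_commute (f : A) (P : Weyl n A) :
    Commute (weylAct n f P) (LinearMap.mulLeft ℂ (X : PowModule f)) := by
  obtain ⟨Q, rfl⟩ := RingQuot.mkAlgHom_surjective ℂ (WeylRel n A) P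
  rw [weylAct, RingQuot.liftAlgHom_mkAlgHom_apply]
  change Commute (freeAct n f Q) _
  induction Q using FreeAlgebra.induction with
  | grade0 r => rw [AlgHom.commutes]; exact Algebra.commutes r _
  | grade1 x =>
    rcases x with a | i
    · ext1 g
      simp only [freeAct, FreeAlgebra.lift_ι_apply, Sum.elim_inl, Module.End.mul_apply,
        LinearMap.mulLeft_apply]
      ring
    · ext1 g
      simp only [freeAct, FreeAlgebra.lift_ι_apply, Sum.elim_inr, Module.End.mul_apply,
        LinearMap.mulLeft_apply, pdAct_apply, Derivation.leibniz, coeffDer_X, smul_eq_mul]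
      ring
  | mul a b ha hb => rw [map_mul]; exact ha.mul_left hb
  | add a b ha hb => rw [map_add]; exact ha.add_left hb

/-- The action of `D[s]` on `A[s, 1/f] · f^s`; the variable `s` acts by multiplication. -/
def act (f : A) : (Weyl n A)[X] →+* Module.End ℂ (PowModule f) :=
  eval₂RingHom' (weylAct n f : Weyl n A →+* Module.End ℂ (PowModule f))
    (LinearMap.mulLeft ℂ (X : PowModule f)) (weylAct_commute n f)

/-- The Bernstein functional equation: `P(s) f · f^s = b(s) · f^s` for some `P(s) ∈ D[s]`. -/
def FunctionalEq (f : A) (b : ℂ[X]) : Prop :=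
  ∃ P : (Weyl n A)[X],
    act n f (P * coefS n A f) (fs f) = b.map (algebraMap ℂ (Localization.Away f)) * fs f

/-- `b` is a monic polynomial of minimal degree satisfying the functional equation. -/
def IsBFunction (f : A) (b : ℂ[X]) : Prop :=
  b.Monic ∧ FunctionalEq n f b ∧
    ∀ c : ℂ[X], c.Monic → FunctionalEq n f c → b.natDegree ≤ c.natDegree

open Classical in
/-- The `b`-function of `f` over the Weyl algebra with coefficients in `A`
(`0` if no polynomial satisfies `IsBFunction`). -/
def bFunction (f : A) : ℂ[X] :=
  if h : ∃ b, IsBFunction n f b then h.choose else 0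

/-- The left ideal `ann_{D[s]}(f^s)`. -/
def annFs (f : A) : Ideal (Weyl n A)[X] where
  carrier := {P | act n f P (fs f) = 0}
  add_mem' {P Q} hP hQ := by
    simp only [Set.mem_ofPred_eq] at hP hQ ⊢
    rw [map_add, LinearMap.add_apply, hP, hQ, add_zero]
  zero_mem' := by simp
  smul_mem' P Q hQ := by
    simp only [Set.mem_ofPred_eq] at hQ ⊢
    rw [smul_eq_mul, map_mul, Module.End.mul_apply, hQ, map_zero]

/-- The left ideal `ann_{D[s]}(f^s) + D[s]⟨f⟩`. -/
def bIdeal (f : A) : Ideal (Weyl n A)[X] := annFs n f ⊔ Ideal.span {coefS n A f}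

variable (A) in
/-- The central element `s + α` of `D[s]`. -/
def sAdd (α : ℂ) : (Weyl n A)[X] := X + C (algebraMap ℂ (Weyl n A) α)

/-- The quotient `J : q = {P | P q ∈ J}` of a left ideal by a (central) element. -/
def colon {R : Type} [Ring R] (J : Ideal R) (q : R) : Ideal R where
  carrier := {P | P * q ∈ J}
  add_mem' {P Q} hP hQ := by
    simp only [Set.mem_ofPred_eq] at hP hQ ⊢
    rw [add_mul]
    exact J.add_mem hP hQ
  zero_mem' := by simp
  smul_mem' P Q hQ := by
    simp only [Set.mem_ofPred_eq] at hQ ⊢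
    rw [smul_eq_mul, mul_assoc]
    exact J.mul_mem_left P hQ

/-- The left ideal `I_{α,i} = (I : (s+α)^i) + D[s]⟨s+α⟩`, `I = ann_{D[s]}(f^s) + D[s]⟨f⟩`. -/
def stratIdeal (f : A) (α : ℂ) (i : ℕ) : Ideal (Weyl n A)[X] :=
  colon (bIdeal n f) (sAdd n A α ^ i) ⊔ Ideal.span {sAdd n A α}

end Weyl

variable {n : ℕ}

/-- The maximal ideal `𝔪_p` of the polynomials vanishing at `p`. -/
def maxIdeal (p : Fin n → ℂ) : Ideal (MvPolynomial (Fin n) ℂ) := RingHom.ker (MvPolynomial.eval p)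

instance (p : Fin n → ℂ) : (maxIdeal p).IsPrime := RingHom.ker_isPrime _

/-- The local ring `ℂ[x₁, …, xₙ]_p`. -/
abbrev LocalRingAt (p : Fin n → ℂ) : Type := Localization (maxIdeal p).primeCompl

/-- The global Bernstein-Sato polynomial `b_f(s)`. -/
def globalB (f : MvPolynomial (Fin n) ℂ) : ℂ[X] := bFunction n f

/-- The local Bernstein-Sato polynomial `b_{f,p}(s)`. -/
def localB (f : MvPolynomial (Fin n) ℂ) (p : Fin n → ℂ) : ℂ[X] :=
  bFunction n (algebraMap _ (LocalRingAt p) f)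

/-- `m_α`: the multiplicity of `α` as a root of `b_f(-s)`. -/
def globalMult (f : MvPolynomial (Fin n) ℂ) (α : ℂ) : ℕ := (globalB f).rootMultiplicity (-α)

/-- `m_α(p)`: the multiplicity of `α` as a root of `b_{f,p}(-s)`. -/
def localMult (f : MvPolynomial (Fin n) ℂ) (α : ℂ) (p : Fin n → ℂ) : ℕ :=
  (localB f p).rootMultiplicity (-α)

/-- The affine variety `V_{α,i} = V(I_{α,i} ∩ ℂ[x])`. -/
def stratVar (f : MvPolynomial (Fin n) ℂ) (α : ℂ) (i : ℕ) : Set (Fin n → ℂ) :=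
  MvPolynomial.zeroLocus ℂ
    (Ideal.comap (coefS n (MvPolynomial (Fin n) ℂ)) (stratIdeal n f α i))

end

end BernsteinSato

namespace BernsteinSato

/-! ### Bernstein's inequality and descending chains of Weyl algebra submodules. -/

section BernsteinInequality

open MvPolynomial

variable {K : Type*} [Field K] {V : Type*} [AddCommGroup V] [Module K V]

/-! Everything is read off the left ideal `I` of operators `P` with `P f^s ∈ D[s] f · f^s`. A
polynomial `b(s)` satisfies the functional equation exactly when `b ∈ I`, so the `b`-function is the
monic generator of `I ∩ ℂ[s]`, globally and locally, once this ideal is nonzero. The proof has three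
ingredients.

Existence. Over the field `ℂ(s)`, the module `ℂ(s) ⊗ ℂ[x][s, 1/f] f^s` carries a filtration by
numerator degree and pole order whose `v`-th step has dimension `O(v^n)`. By Bernstein's inequality
a nonzero filtered module over the Weyl algebra has growth at least a constant times `v^n`, so the
descending chain generated by the `f^k f^s` cannot have arbitrarily many strict steps between
consecutive generators. Hence `f^k f^s` lies in the span of `D[s] f^(k+1) f^s` for some `k`;
clearing denominators in `ℂ[s]` and substituting `s ↦ s - k` gives a nonzero `b`
(`exists_functionalEq`). The same equation holds after localization, so local `b`-functions exist
and divide the global one.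

Localization. An operator over `S⁻¹A` becomes an operator over `A` after left multiplication by some
`h ∈ S`. Thus `P` lies in the localized ideal exactly when `h P ∈ I` for some `h ∈ S`
(`locMapS_mem_bIdeal`, `exists_coefS_mul_mem_bIdeal`).

Multiplicities. A point `p` is outside `V_{α,i}` iff some `h` with `h(p) ≠ 0` satisfies `(h + P
(s+α)) (s+α)^i ∈ I` for some `P`. Near `p` the function `h` is a unit, and such a relation would
lower the exponent of `s+α` in `b_{f,p}` if it exceeded `i`. Conversely, if `b_{f,p} = (s+α)^m c`
with `m ≤ i` and `c(-α) ≠ 0`, then `c` is a nonzero constant modulo `s+α`, and clearing denominators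
produces `h`. The stratification is then bookkeeping, because a monic complex polynomial is
determined by its root multiplicities. -/

theorem exists_algHom_of_commute {ι R : Type*} [Ring R] [Algebra K R] (y : ι → R)
    (hy : ∀ i j, Commute (y i) (y j)) :
    ∃ φ : MvPolynomial ι K →ₐ[K] R, ∀ i, φ (X i) = y i := by
  have hc : ∀ a ∈ Set.range y, ∀ b ∈ Set.range y, a * b = b * a := by
    rintro _ ⟨i, rfl⟩ _ ⟨j, rfl⟩
    exact hy i j
  have := Algebra.isMulCommutative_adjoin K hc
  let _ : CommRing (Algebra.adjoin K (Set.range y)) :=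
    { (inferInstance : Ring (Algebra.adjoin K (Set.range y))) with
      mul_comm := fun a b => this.is_comm.comm a b }
  let g : ι → Algebra.adjoin K (Set.range y) :=
    fun i => ⟨y i, Algebra.subset_adjoin ⟨i, rfl⟩⟩
  exact ⟨(Algebra.adjoin K (Set.range y)).val.comp (aeval g), fun i => by simp [g]⟩

/-- The Weyl algebra relations between operators `x i` and `d i`. -/
structure WeylAction {n : ℕ} (x d : Fin n → Module.End K V) : Prop where
  x_comm : ∀ i j, Commute (x i) (x j)
  d_comm : ∀ i j, Commute (d i) (d j)
  d_x : ∀ i j, d i * x j - x j * d i = if i = j then 1 else 0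

/-- The operator with total symbol `P`, with the `x i` to the left of the `d i`, where `φ` and `ψ`
evaluate polynomials at the `x i` and at the `d i`. -/
noncomputable def symbolOp {n : ℕ} (φ ψ : MvPolynomial (Fin n) K →ₐ[K] Module.End K V) :
    MvPolynomial (Fin n ⊕ Fin n) K →ₗ[K] Module.End K V :=
  (basisMonomials (Fin n ⊕ Fin n) K).constr K fun m =>
    φ (monomial (Finsupp.sumFinsuppEquivProdFinsupp m).1 1) *
      ψ (monomial (Finsupp.sumFinsuppEquivProdFinsupp m).2 1)

theorem symbolOp_monomial {n : ℕ} (φ ψ : MvPolynomial (Fin n) K →ₐ[K] Module.End K V)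
    (m : Fin n ⊕ Fin n →₀ ℕ) (c : K) : symbolOp φ ψ (monomial m c) =
      c • (φ (monomial (Finsupp.sumFinsuppEquivProdFinsupp m).1 1) *
        ψ (monomial (Finsupp.sumFinsuppEquivProdFinsupp m).2 1)) := by
  have h := (basisMonomials (Fin n ⊕ Fin n) K).constr_basis K (fun m =>
    φ (monomial (Finsupp.sumFinsuppEquivProdFinsupp m).1 1) *
      ψ (monomial (Finsupp.sumFinsuppEquivProdFinsupp m).2 1)) m
  rw [coe_basisMonomials] at h
  rw [← h, ← mul_one c, ← smul_eq_mul, ← smul_monomial, map_smul, smul_eq_mul, mul_one]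
  rfl

theorem symbolOp_C {n : ℕ} (φ ψ : MvPolynomial (Fin n) K →ₐ[K] Module.End K V) (c : K) :
    symbolOp φ ψ (C c) = c • 1 := by
  rw [← monomial_zero', symbolOp_monomial]
  have h1 : (Finsupp.sumFinsuppEquivProdFinsupp (0 : Fin n ⊕ Fin n →₀ ℕ)).1 = 0 := by
    ext; simp
  have h2 : (Finsupp.sumFinsuppEquivProdFinsupp (0 : Fin n ⊕ Fin n →₀ ℕ)).2 = 0 := by
    ext; simp
  rw [h1, h2, monomial_zero', C_1, map_one, map_one, mul_one]

section

variable {n : ℕ} {x d : Fin n → Module.End K V}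
  {φ ψ : MvPolynomial (Fin n) K →ₐ[K] Module.End K V}

theorem WeylAction.comm_d (h : WeylAction x d) (hφ : ∀ i, φ (X i) = x i) (i : Fin n)
    (p : MvPolynomial (Fin n) K) : d i * φ p - φ p * d i = φ (pderiv i p) := by
  induction p using MvPolynomial.induction_on with
  | C a =>
    rw [pderiv_C, map_zero, ← algebraMap_eq, AlgHom.commutes]
    exact sub_eq_zero.2 (Algebra.commutes a (d i)).symm
  | add p q hp hq => rw [map_add, map_add, map_add, ← hp, ← hq]; noncomm_ring
  | mul_X p j hp =>
    have hx : d i * x j = x j * d i + φ (pderiv i (X j)) := by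
      rw [← sub_eq_iff_eq_add', h.d_x, pderiv_X, Pi.single_apply]
      split_ifs with h1 h2 h2
      · simp
      · exact absurd h1.symm h2
      · exact absurd h2.symm h1
      · simp
    have hp' := sub_eq_iff_eq_add'.1 hp
    rw [pderiv_mul, map_add, map_mul, map_mul, map_mul, ← hp, hφ, ← mul_assoc, hp', mul_assoc _ (x j),
      ← sub_eq_iff_eq_add'.2 hx, ← hp]
    noncomm_ring

theorem WeylAction.comm_x (h : WeylAction x d) (hψ : ∀ i, ψ (X i) = d i) (i : Fin n)
    (p : MvPolynomial (Fin n) K) : ψ p * x i - x i * ψ p = ψ (pderiv i p) := by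
  induction p using MvPolynomial.induction_on with
  | C a =>
    rw [pderiv_C, map_zero, ← algebraMap_eq, AlgHom.commutes]
    exact sub_eq_zero.2 (Algebra.commutes a (x i))
  | add p q hp hq => rw [map_add, map_add, map_add, ← hp, ← hq]; noncomm_ring
  | mul_X p j hp =>
    have hx : ψ (pderiv i (X j)) = d j * x i - x i * d j := by
      rw [h.d_x, pderiv_X, Pi.single_apply]
      split_ifs <;> simp
    rw [pderiv_mul, map_add, map_mul, map_mul, map_mul, ← hp, hψ, hx]
    noncomm_ring

/-- With the `x i` written on the left, only the `ψ` factor of a monomial fails to commute with `x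
i`, and there the commutator is differentiation by the dual variable. -/
theorem WeylAction.symbolOp_comm_x (h : WeylAction x d) (hφ : ∀ i, φ (X i) = x i)
    (hψ : ∀ i, ψ (X i) = d i) (i : Fin n) (P : MvPolynomial (Fin n ⊕ Fin n) K) :
    symbolOp φ ψ P * x i - x i * symbolOp φ ψ P = symbolOp φ ψ (pderiv (Sum.inr i) P) := by
  induction P using MvPolynomial.induction_on' with
  | add p q hp hq => rw [map_add, map_add, map_add, ← hp, ← hq]; noncomm_ring
  | monomial m c =>
    rw [pderiv_monomial, symbolOp_monomial, symbolOp_monomial]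
    have h1 : (Finsupp.sumFinsuppEquivProdFinsupp (m - Finsupp.single (Sum.inr i) 1)).1 =
        (Finsupp.sumFinsuppEquivProdFinsupp m).1 := by
      ext j; simp
    have h2 : (Finsupp.sumFinsuppEquivProdFinsupp (m - Finsupp.single (Sum.inr i) 1)).2 =
        (Finsupp.sumFinsuppEquivProdFinsupp m).2 - Finsupp.single i 1 := by
      ext j; simp [Finsupp.single_apply]
    have h3 := h.comm_x hψ i (monomial (Finsupp.sumFinsuppEquivProdFinsupp m).2 1)
    have h4 : x i * φ (monomial (Finsupp.sumFinsuppEquivProdFinsupp m).1 1) =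
        φ (monomial (Finsupp.sumFinsuppEquivProdFinsupp m).1 1) * x i := by
      rw [← hφ, ← map_mul, ← map_mul, mul_comm]
    have h5 : (monomial ((Finsupp.sumFinsuppEquivProdFinsupp m).2 - Finsupp.single i 1)
        (m (Sum.inr i) : K)) = (m (Sum.inr i) : K) •
          monomial ((Finsupp.sumFinsuppEquivProdFinsupp m).2 - Finsupp.single i 1) (1 : K) := by
      rw [smul_monomial, smul_eq_mul, mul_one]
    rw [pderiv_monomial, Finsupp.snd_sumFinsuppEquivProdFinsupp, one_mul, h5, map_smul] at h3
    rw [h1, h2, mul_smul, ← mul_smul_comm (m (Sum.inr i) : K), ← h3, smul_mul_assoc, mul_smul_comm, ← smul_sub,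
      ← mul_assoc (x i), h4]
    noncomm_ring

theorem WeylAction.symbolOp_comm_d (h : WeylAction x d) (hφ : ∀ i, φ (X i) = x i)
    (hψ : ∀ i, ψ (X i) = d i) (i : Fin n) (P : MvPolynomial (Fin n ⊕ Fin n) K) :
    d i * symbolOp φ ψ P - symbolOp φ ψ P * d i = symbolOp φ ψ (pderiv (Sum.inl i) P) := by
  induction P using MvPolynomial.induction_on' with
  | add p q hp hq => rw [map_add, map_add, map_add, ← hp, ← hq]; noncomm_ring
  | monomial m c =>
    rw [pderiv_monomial, symbolOp_monomial, symbolOp_monomial]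
    have h1 : (Finsupp.sumFinsuppEquivProdFinsupp (m - Finsupp.single (Sum.inl i) 1)).2 =
        (Finsupp.sumFinsuppEquivProdFinsupp m).2 := by
      ext j; simp
    have h2 : (Finsupp.sumFinsuppEquivProdFinsupp (m - Finsupp.single (Sum.inl i) 1)).1 =
        (Finsupp.sumFinsuppEquivProdFinsupp m).1 - Finsupp.single i 1 := by
      ext j; simp [Finsupp.single_apply]
    have h3 := h.comm_d hφ i (monomial (Finsupp.sumFinsuppEquivProdFinsupp m).1 1)
    have h4 : ψ (monomial (Finsupp.sumFinsuppEquivProdFinsupp m).2 1) * d i =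
        d i * ψ (monomial (Finsupp.sumFinsuppEquivProdFinsupp m).2 1) := by
      rw [← hψ, ← map_mul, ← map_mul, mul_comm]
    have h5 : (monomial ((Finsupp.sumFinsuppEquivProdFinsupp m).1 - Finsupp.single i 1)
        (m (Sum.inl i) : K)) = (m (Sum.inl i) : K) •
          monomial ((Finsupp.sumFinsuppEquivProdFinsupp m).1 - Finsupp.single i 1) (1 : K) := by
      rw [smul_monomial, smul_eq_mul, mul_one]
    rw [pderiv_monomial, Finsupp.fst_sumFinsuppEquivProdFinsupp, one_mul, h5, map_smul] at h3
    rw [h1, h2, mul_smul, ← smul_mul_assoc (m (Sum.inl i) : K), ← h3, smul_mul_assoc, mul_smul_comm, ← smul_sub,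
      mul_assoc _ _ (d i), h4]
    noncomm_ring

end

theorem totalDegree_pderiv_le {σ : Type*} (i : σ) (P : MvPolynomial σ K) {v : ℕ}
    (hP : P.totalDegree ≤ v + 1) : (pderiv i P).totalDegree ≤ v := by
  rw [totalDegree, Finset.sup_le_iff]
  intro m hm
  rw [mem_support_iff, coeff_pderiv] at hm
  have h := le_totalDegree (mem_support_iff.2 (left_ne_zero_of_mul hm))
  rw [Finsupp.sum_add_index' (fun _ => rfl) (fun _ _ _ => rfl), Finsupp.sum_single_index rfl] at h
  omega

theorem eq_C_of_pderiv_eq_zero [CharZero K] {σ : Type*} (P : MvPolynomial σ K)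
    (h : ∀ i, pderiv i P = 0) : ∃ c, P = C c := by
  classical
  refine ⟨coeff 0 P, ?_⟩
  ext m
  rw [coeff_C]
  split_ifs with hm
  · rw [hm]
  · obtain ⟨i, hi⟩ : ∃ i, m i ≠ 0 := by
      by_contra! hc
      exact hm (by ext i; simp [hc i])
    have h1 := congrArg (coeff (m - Finsupp.single i 1)) (h i)
    rw [coeff_pderiv, tsub_add_cancel_of_le (by simpa [Nat.one_le_iff_ne_zero] using hi),
      coeff_zero] at h1
    exact (mul_eq_zero.1 h1).resolve_right (Nat.cast_add_one_ne_zero _)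

variable {n : ℕ} {x d : Fin n → Module.End K V}
  {φ ψ : MvPolynomial (Fin n) K →ₐ[K] Module.End K V}

/-- Commutators with `x i` and `d i` replace the symbol by its partial derivatives, lowering both
the degree and the filtration index by one. By induction all partial derivatives of `P` vanish, so
in characteristic zero `P` is constant, and the nonzero vector `u` detects constants. -/
theorem WeylAction.eq_zero_of_symbolOp_eq_zero [CharZero K] (h : WeylAction x d)
    (hφ : ∀ i, φ (X i) = x i) (hψ : ∀ i, ψ (X i) = d i) (G : ℕ → Submodule K V)
    (hG : Monotone G) (hx : ∀ i v, ∀ g ∈ G v, x i g ∈ G (v + 1))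
    (hd : ∀ i v, ∀ g ∈ G v, d i g ∈ G (v + 1)) {u : V} (hu : u ∈ G 0) (hu0 : u ≠ 0) (v : ℕ) :
    ∀ P : MvPolynomial (Fin n ⊕ Fin n) K, P.totalDegree ≤ v →
      (∀ g ∈ G v, symbolOp φ ψ P g = 0) → P = 0 := by
  have hconst : ∀ c : K, symbolOp φ ψ (C c) u = 0 → c = 0 := by
    intro c hc
    rw [symbolOp_C, LinearMap.smul_apply, Module.End.one_apply] at hc
    exact (smul_eq_zero.1 hc).resolve_right hu0
  induction v with
  | zero =>
    intro P hP hPG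
    rw [Nat.le_zero, totalDegree_eq_zero_iff_eq_C] at hP
    rw [hP] at hPG ⊢
    rw [hconst _ (hPG u hu), C_0]
  | succ v ih =>
    intro P hP hPG
    have hder : ∀ i, pderiv i P = 0 := by
      intro i
      apply ih _ (totalDegree_pderiv_le i P hP)
      intro g hg
      rcases i with i | i
      · rw [← h.symbolOp_comm_d hφ hψ, LinearMap.sub_apply, Module.End.mul_apply,
          Module.End.mul_apply, hPG _ (hG (Nat.le_succ v) hg), hPG _ (hd i v g hg), map_zero,
          sub_zero]
      · rw [← h.symbolOp_comm_x hφ hψ, LinearMap.sub_apply, Module.End.mul_apply,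
          Module.End.mul_apply, hPG _ (hG (Nat.le_succ v) hg), hPG _ (hx i v g hg), map_zero,
          sub_zero]
    obtain ⟨c, rfl⟩ := eq_C_of_pderiv_eq_zero P hder
    rw [hconst _ (hPG u (hG (Nat.zero_le _) hu)), C_0]

theorem algHom_monomial_mem (hφ : ∀ i, φ (X i) = x i) (G : ℕ → Submodule K V)
    (hx : ∀ i v, ∀ g ∈ G v, x i g ∈ G (v + 1)) (m : Fin n →₀ ℕ) :
    ∀ v, ∀ g ∈ G v, φ (monomial m 1) g ∈ G (v + m.sum fun _ e => e) := by
  induction m using Finsupp.induction_linear with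
  | zero =>
    intro v g hg
    rw [monomial_zero', C_1, map_one]
    simpa using hg
  | add a b ha hb =>
    intro v g hg
    have h1 : (monomial (a + b) (1 : K)) = monomial a 1 * monomial b 1 := by
      rw [monomial_mul, mul_one]
    rw [h1, map_mul, Module.End.mul_apply, Finsupp.sum_add_index' (fun _ => rfl) (fun _ _ _ => rfl),
      add_comm (a.sum _), ← add_assoc]
    exact ha _ _ (hb _ _ hg)
  | single i k =>
    intro v g hg
    rw [Finsupp.sum_single_index rfl, ← X_pow_eq_monomial, map_pow, hφ]
    induction k with
    | zero => simpa using hg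
    | succ k ih => rw [pow_succ', Module.End.mul_apply, ← add_assoc]; exact hx _ _ _ ih

theorem symbolOp_mem (hφ : ∀ i, φ (X i) = x i) (hψ : ∀ i, ψ (X i) = d i) (G : ℕ → Submodule K V)
    (hG : Monotone G) (hx : ∀ i v, ∀ g ∈ G v, x i g ∈ G (v + 1))
    (hd : ∀ i v, ∀ g ∈ G v, d i g ∈ G (v + 1)) (P : MvPolynomial (Fin n ⊕ Fin n) K) {v w : ℕ}
    (hP : P.totalDegree ≤ w) {g : V} (hg : g ∈ G v) : symbolOp φ ψ P g ∈ G (v + w) := by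
  rw [P.as_sum, map_sum, LinearMap.sum_apply]
  refine Submodule.sum_mem _ fun m hm => ?_
  rw [symbolOp_monomial, LinearMap.smul_apply, Module.End.mul_apply]
  refine Submodule.smul_mem _ _ (hG ?_ (algHom_monomial_mem hφ G hx _ _ _
    (algHom_monomial_mem hψ G hd _ _ _ hg)))
  have h1 := (le_totalDegree hm).trans hP
  rw [Finsupp.sum_fintype _ _ (fun _ => rfl)] at h1 ⊢
  rw [Finsupp.sum_fintype _ _ (fun _ => rfl)]
  simp only [Fintype.sum_sum_type, Finsupp.fst_sumFinsuppEquivProdFinsupp,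
    Finsupp.snd_sumFinsuppEquivProdFinsupp] at h1 ⊢
  omega

theorem finrank_restrictDegree (σ : Type*) [Fintype σ] (v : ℕ) :
    Module.finrank K (restrictDegree σ K v) = (v + 1) ^ Fintype.card σ := by
  have e : {m : σ →₀ ℕ | ∀ i, m i ≤ v} ≃ (σ → Fin (v + 1)) :=
    { toFun := fun m i => ⟨m.1 i, Nat.lt_succ_of_le (m.2 i)⟩
      invFun := fun a => ⟨Finsupp.equivFunOnFinite.symm fun i => (a i : ℕ),
        fun i => Nat.le_of_lt_succ (a i).2⟩
      left_inv := fun m => by ext; simp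
      right_inv := fun a => by ext; simp }
  rw [restrictDegree, Module.finrank_eq_nat_card_basis (basisRestrictSupport K {m : σ →₀ ℕ | ∀ i, m i ≤ v}),
    Nat.card_congr e, Nat.card_fun]
  simp

/-- **Bernstein's inequality** for a filtered module over the Weyl algebra. -/
theorem WeylAction.pow_le_finrank [CharZero K] (h : WeylAction x d) (G : ℕ → Submodule K V)
    (hG : Monotone G) (hx : ∀ i v, ∀ g ∈ G v, x i g ∈ G (v + 1))
    (hd : ∀ i v, ∀ g ∈ G v, d i g ∈ G (v + 1)) [∀ v, FiniteDimensional K (G v)]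
    {u : V} (hu : u ∈ G 0) (hu0 : u ≠ 0) (v : ℕ) :
    (v + 1) ^ n ≤ Module.finrank K (G (4 * n * v)) := by
  obtain ⟨φ, hφ⟩ := exists_algHom_of_commute (K := K) x h.x_comm
  obtain ⟨ψ, hψ⟩ := exists_algHom_of_commute (K := K) d h.d_comm
  -- A polynomial in `2n` variables with every exponent at most `v` has total degree at most `2nv`.
  -- Box-shaped degree bounds make the dimension exactly `(v+1)^(2n)`.
  set w := 2 * n * v with hw
  have hdeg : ∀ P ∈ restrictDegree (Fin n ⊕ Fin n) K v, P.totalDegree ≤ w := by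
    intro P hP
    rw [mem_restrictDegree] at hP
    rw [totalDegree, Finset.sup_le_iff]
    intro m hm
    rw [Finsupp.sum_fintype _ _ (fun _ => rfl)]
    refine (Finset.sum_le_card_nsmul _ _ v fun i _ => hP m hm i).trans_eq ?_
    rw [Finset.card_univ, Fintype.card_sum, Fintype.card_fin, smul_eq_mul, hw]
    ring
  have h4 : 4 * n * v = w + w := by rw [hw]; ring
  rw [h4]
  let T : restrictDegree (Fin n ⊕ Fin n) K v →ₗ[K] G w →ₗ[K] G (w + w) :=
    { toFun := fun P => (symbolOp φ ψ P.1).restrict fun g hg =>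
        symbolOp_mem hφ hψ G hG hx hd P.1 (hdeg P.1 P.2) hg
      map_add' := fun P Q => by ext; simp
      map_smul' := fun c P => by ext; simp }
  have hT : Function.Injective T := by
    rw [injective_iff_map_eq_zero]
    intro P hP
    apply Subtype.ext
    apply h.eq_zero_of_symbolOp_eq_zero hφ hψ G hG hx hd hu hu0 w P.1 (hdeg P.1 P.2)
    intro g hg
    exact congrArg Subtype.val (LinearMap.congr_fun hP ⟨g, hg⟩)
  -- The symbols embed into `Hom(G w, G (2w))`, so `(v+1)^(2n) ≤ dim G w · dim G (2w) ≤ (dim G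
  -- (2w))^2`; the claim is the square root of this.
  have h1 := LinearMap.finrank_le_finrank_of_injective hT
  rw [finrank_restrictDegree, Module.finrank_linearMap, Fintype.card_sum, Fintype.card_fin,
    pow_add] at h1
  have h2 : Module.finrank K (G w) ≤ Module.finrank K (G (w + w)) :=
    Submodule.finrank_mono (hG (Nat.le_add_right w w))
  exact Nat.mul_self_le_mul_self_iff.1 (h1.trans (Nat.mul_le_mul_right _ h2))

/-- A descending chain of submodules of a module with a filtration of dimension `O(vⁿ)`
becomes stationary. -/
theorem WeylAction.exists_mem_of_chain [CharZero K] (h : WeylAction x d) (G : ℕ → Submodule K V)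
    (hG : Monotone G) (hx : ∀ i v, ∀ g ∈ G v, x i g ∈ G (v + 1))
    (hd : ∀ i v, ∀ g ∈ G v, d i g ∈ G (v + 1)) [∀ v, FiniteDimensional K (G v)]
    {c : ℕ} (hc : 0 < c) (hfin : ∀ v, Module.finrank K (G v) ≤ (c * v + 1) ^ n)
    (N : ℕ → Submodule K V) (hN : Antitone N) (hNx : ∀ i k, ∀ g ∈ N k, x i g ∈ N k)
    (hNd : ∀ i k, ∀ g ∈ N k, d i g ∈ N k) (u : ℕ → V) (huN : ∀ k, u k ∈ N k)
    (huG : ∀ k, ∃ v, u k ∈ G v) : ∃ k, u k ∈ N (k + 1) := by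
  by_contra! hno
  choose r hr using huG
  -- Each strict step costs at least `(v+1)^n` dimensions: Bernstein's inequality in `N k / N
  -- (k+1)`, combined with rank-nullity.
  have key : ∀ (k w v : ℕ), r k ≤ w →
      (v + 1) ^ n + Module.finrank K (G (4 * n * v + w) ⊓ N (k + 1) : Submodule K V) ≤
        Module.finrank K (G (4 * n * v + w) ⊓ N k : Submodule K V) := by
    intro k w v hw
    have hle : ∀ i, N (k + 1) ≤ (N (k + 1)).comap (x i) := fun i g hg => hNx i _ g hg
    have hle' : ∀ i, N (k + 1) ≤ (N (k + 1)).comap (d i) := fun i g hg => hNd i _ g hg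
    let x' : Fin n → Module.End K (V ⧸ N (k + 1)) := fun i => (N (k + 1)).mapQ _ (x i) (hle i)
    let d' : Fin n → Module.End K (V ⧸ N (k + 1)) := fun i => (N (k + 1)).mapQ _ (d i) (hle' i)
    have h' : WeylAction x' d' := by
      refine ⟨fun i j => ?_, fun i j => ?_, fun i j => ?_⟩
      · ext g
        exact congrArg (N (k + 1)).mkQ (LinearMap.congr_fun (h.x_comm i j) g)
      · ext g
        exact congrArg (N (k + 1)).mkQ (LinearMap.congr_fun (h.d_comm i j) g)
      · ext g
        refine (congrArg (N (k + 1)).mkQ (LinearMap.congr_fun (h.d_x i j) g)).trans ?_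
        split_ifs <;> simp
    -- The shift by `w` puts the nonzero class of `u k` into level `0`, as the inequality requires.
    let G' : ℕ → Submodule K (V ⧸ N (k + 1)) := fun v => (G (v + w) ⊓ N k).map (N (k + 1)).mkQ
    have hmain := h'.pow_le_finrank G'
      (fun a b hab => Submodule.map_mono (inf_le_inf_right _ (hG (by omega))))
      (by
        rintro i a _ ⟨g, hg, rfl⟩
        refine ⟨x i g, ⟨?_, hNx i _ g hg.2⟩, rfl⟩
        rw [add_right_comm]
        exact hx i _ g hg.1)
      (by
        rintro i a _ ⟨g, hg, rfl⟩
        refine ⟨d i g, ⟨?_, hNd i _ g hg.2⟩, rfl⟩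
        rw [add_right_comm]
        exact hd i _ g hg.1)
      (u := (N (k + 1)).mkQ (u k)) ⟨u k, ⟨hG (by omega) (hr k), huN k⟩, rfl⟩
      (by simpa using hno k) v
    set B := G (4 * n * v + w) ⊓ N k with hB
    have hrn := LinearMap.finrank_range_add_finrank_ker ((N (k + 1)).mkQ.domRestrict B)
    have hrange : LinearMap.range ((N (k + 1)).mkQ.domRestrict B) = G' (4 * n * v) := by
      rw [LinearMap.range_domRestrict]
    have hker : Module.finrank K (LinearMap.ker ((N (k + 1)).mkQ.domRestrict B)) =
        Module.finrank K (G (4 * n * v + w) ⊓ N (k + 1) : Submodule K V) := by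
      rw [LinearMap.ker_domRestrict, Submodule.ker_mkQ]
      have h1 : G (4 * n * v + w) ⊓ N (k + 1) = (N (k + 1)) ⊓ B := by
        rw [hB, inf_comm, inf_left_comm, inf_eq_left.2 (hN (Nat.le_succ k)), inf_comm]
      rw [h1, ← Submodule.finrank_map_subtype_eq, Submodule.map_comap_subtype, inf_comm]
    rw [hrange, hker] at hrn
    omega
  have sum : ∀ (m w v : ℕ), (∀ k < m, r k ≤ w) →
      m * (v + 1) ^ n + Module.finrank K (G (4 * n * v + w) ⊓ N m : Submodule K V) ≤
        Module.finrank K (G (4 * n * v + w)) := by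
    intro m w v
    induction m with
    | zero =>
      intro _
      rw [zero_mul, zero_add]
      exact Submodule.finrank_mono inf_le_left
    | succ m ih =>
      intro hm
      have h1 := ih fun k hk => hm k (by omega)
      have h2 := key m w v (hm m (by omega))
      rw [add_mul, one_mul]
      omega
  -- Taking `v = w`, `m` strict steps need dimension `m (w+1)^n`, while the growth bound allows only
  -- `(c(4n+1))^n (w+1)^n`. The number `m` is fixed first; `w` is then chosen large enough for the
  -- first `m` vectors.
  set m := (c * (4 * n + 1)) ^ n + 1 with hm
  set w := (Finset.range m).sup r with hw
  have h1 := sum m w w fun k hk => Finset.le_sup (Finset.mem_range.2 hk)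
  have h2 := hfin (4 * n * w + w)
  have h3 : (c * (4 * n * w + w) + 1) ^ n ≤ (c * (4 * n + 1)) ^ n * (w + 1) ^ n := by
    rw [← mul_pow]
    refine Nat.pow_le_pow_left ?_ n
    have : 0 < c * (4 * n + 1) := by positivity
    calc c * (4 * n * w + w) + 1 = c * (4 * n + 1) * w + 1 := by ring
      _ ≤ c * (4 * n + 1) * w + c * (4 * n + 1) := by omega
      _ = _ := by ring
  have h4 : 0 < (w + 1) ^ n := by positivity
  rw [hm, add_mul, one_mul] at h1
  omega

end BernsteinInequality

/-! ### The action of `D[s]`, the ideal `I`, and the `b`-function as a generator. -/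

noncomputable section Action

open Polynomial

variable {n : ℕ} {A : Type} [CommRing A] [Algebra ℂ A] [Partials n A]

variable (A) in
/-- The operator `∂ᵢ`. -/
def Weyl.del (i : Fin n) : Weyl n A :=
  RingQuot.mkAlgHom ℂ (WeylRel n A) (FreeAlgebra.ι ℂ (Sum.inr i))

theorem Weyl.coef_algebraMap (c : ℂ) :
    Weyl.coef n A (algebraMap ℂ A c) = algebraMap ℂ (Weyl n A) c := by
  have := RingQuot.mkAlgHom_rel ℂ (WeylRel.scalar (n := n) (A := A) c)
  rw [AlgHom.commutes] at this
  exact this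

theorem Weyl.del_mul_coef (i : Fin n) (a : A) : Weyl.del A i * Weyl.coef n A a =
    Weyl.coef n A a * Weyl.del A i + Weyl.coef n A (Partials.pd i a) := by
  have := RingQuot.mkAlgHom_rel ℂ (WeylRel.leibniz (n := n) (A := A) i a)
  rw [map_mul, map_add, map_mul] at this
  exact this

theorem weylS_induction {p : (Weyl n A)[X] → Prop} (coef : ∀ a, p (coefS n A a))
    (del : ∀ i, p (C (Weyl.del A i))) (var : p X) (add : ∀ P Q, p P → p Q → p (P + Q))
    (mul : ∀ P Q, p P → p Q → p (P * Q)) (P : (Weyl n A)[X]) : p P := by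
  have hC : ∀ w : Weyl n A, p (C w) := by
    intro w
    obtain ⟨Q, rfl⟩ := RingQuot.mkAlgHom_surjective ℂ (WeylRel n A) w
    induction Q using FreeAlgebra.induction with
    | grade0 r => rw [AlgHom.commutes, ← Weyl.coef_algebraMap]; exact coef _
    | grade1 x =>
      rcases x with a | i
      · exact coef a
      · exact del i
    | mul a b ha hb => rw [map_mul, map_mul]; exact mul _ _ ha hb
    | add a b ha hb => rw [map_add, map_add]; exact add _ _ ha hb
  induction P using Polynomial.induction_on with
  | C a => exact hC a
  | add P Q hP hQ => exact add _ _ hP hQ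
  | monomial k a h => rw [pow_succ, ← mul_assoc]; exact mul _ _ h var

variable (f : A)

theorem act_C (w : Weyl n A) : act n f (C w) = weylAct n f w := by
  simp [act, eval₂RingHom']

theorem act_coefS (a : A) (g : PowModule f) :
    act n f (coefS n A a) g = C (algebraMap A (Localization.Away f) a) * g := by
  rw [coefS, RingHom.comp_apply, act_C]
  change weylAct n f (RingQuot.mkAlgHom ℂ _ _) g = _
  rw [weylAct, RingQuot.liftAlgHom_mkAlgHom_apply, freeAct, FreeAlgebra.lift_ι_apply]
  rfl

theorem act_del (i : Fin n) (g : PowModule f) : act n f (C (Weyl.del A i)) g = pdAct n f i g := by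
  rw [act_C, Weyl.del, weylAct, RingQuot.liftAlgHom_mkAlgHom_apply, freeAct,
    FreeAlgebra.lift_ι_apply]
  rfl

theorem act_X (g : PowModule f) : act n f X g = X * g := by
  simp [act, eval₂RingHom']

theorem act_mul (P Q : (Weyl n A)[X]) (g : PowModule f) :
    act n f (P * Q) g = act n f P (act n f Q g) := by
  rw [map_mul, Module.End.mul_apply]

theorem act_add (P Q : (Weyl n A)[X]) (g : PowModule f) :
    act n f (P + Q) g = act n f P g + act n f Q g := by
  rw [map_add, LinearMap.add_apply]

variable (n A) in
/-- The inclusion of `ℂ[s]` into `D[s]`. -/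
def scalarS : ℂ[X] →+* (Weyl n A)[X] := mapRingHom (algebraMap ℂ (Weyl n A))

theorem act_scalarS (c : ℂ[X]) (g : PowModule f) : act n f (scalarS n A c) g =
    c.map (algebraMap ℂ (Localization.Away f)) * g := by
  induction c using Polynomial.induction_on with
  | C a =>
    rw [scalarS, coe_mapRingHom, map_C, ← Weyl.coef_algebraMap]
    refine (act_coefS f _ g).trans ?_
    rw [map_C, ← IsScalarTower.algebraMap_apply]
  | add p q hp hq => rw [map_add, act_add, hp, hq, Polynomial.map_add, add_mul]
  | monomial k a h =>
    have hX : scalarS n A X = X := by simp [scalarS]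
    rw [pow_succ', mul_left_comm, RingHom.map_mul, act_mul, h, hX, act_X,
      Polynomial.map_mul (p := X), map_X, mul_assoc]

theorem scalarS_comm (c : ℂ[X]) (P : (Weyl n A)[X]) : Commute (scalarS n A c) P := by
  induction c using Polynomial.induction_on with
  | C a =>
    rw [scalarS, coe_mapRingHom, map_C]
    exact Algebra.commutes (A := (Weyl n A)[X]) a P
  | add p q hp hq => rw [map_add]; exact hp.add_left hq
  | monomial k a h =>
    have hX : scalarS n A X = X := by simp [scalarS]
    rw [pow_succ, ← mul_assoc, map_mul, hX]
    exact h.mul_left (commute_X P)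

theorem sAdd_eq (α : ℂ) : sAdd n A α = scalarS n A (X + C α) := by
  simp [sAdd, scalarS]

theorem mem_annFs {P : (Weyl n A)[X]} : P ∈ annFs n f ↔ act n f P (fs f) = 0 := Iff.rfl

/-- Since `ann(f^s)` is the kernel of `P ↦ P f^s`, membership in `I` can be tested on `f^s`. All
later arguments use `I` in this form. -/
theorem mem_bIdeal {P : (Weyl n A)[X]} :
    P ∈ bIdeal n f ↔ ∃ Q, act n f P (fs f) = act n f (Q * coefS n A f) (fs f) := by
  rw [bIdeal, Submodule.mem_sup]
  constructor
  · rintro ⟨R, hR, S, hS, rfl⟩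
    obtain ⟨Q, rfl⟩ := Ideal.mem_span_singleton'.1 hS
    exact ⟨Q, by rw [act_add, (mem_annFs f).1 hR, zero_add]⟩
  · rintro ⟨Q, hQ⟩
    -- The annihilating summand is `P - Q f`, with the sign carried by the coefficient `-1`.
    refine ⟨P + coefS n A (-1) * (Q * coefS n A f), ?_, Q * coefS n A f, ?_, ?_⟩
    · rw [mem_annFs, act_add, act_mul, ← hQ, act_coefS]
      have h1 : (C (algebraMap A (Localization.Away f) (-1)) : PowModule f) = -1 := by simp
      rw [h1]
      ring
    · exact Ideal.mem_span_singleton'.2 ⟨Q, rfl⟩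
    · rw [add_assoc, ← add_one_mul, ← map_one (coefS n A), ← map_add, neg_add_cancel, map_zero,
        zero_mul, add_zero]

theorem functionalEq_iff {b : ℂ[X]} : FunctionalEq n f b ↔ scalarS n A b ∈ bIdeal n f := by
  rw [mem_bIdeal, act_scalarS]
  exact exists_congr fun Q => eq_comm

/-- The polynomials that satisfy the functional equation. -/
def functionalEqIdeal (n : ℕ) [Partials n A] (f : A) : Ideal ℂ[X] where
  carrier := {b | FunctionalEq n f b}
  add_mem' {a b} ha hb := by
    simp only [Set.mem_ofPred_eq, functionalEq_iff] at ha hb ⊢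
    rw [map_add]
    exact add_mem ha hb
  zero_mem' := by
    simp only [Set.mem_ofPred_eq, functionalEq_iff]
    rw [map_zero]
    exact zero_mem _
  smul_mem' c b hb := by
    simp only [Set.mem_ofPred_eq, functionalEq_iff] at hb ⊢
    rw [smul_eq_mul, map_mul]
    exact Ideal.mul_mem_left _ _ hb

theorem mem_functionalEqIdeal {b : ℂ[X]} : b ∈ functionalEqIdeal n f ↔ FunctionalEq n f b :=
  Iff.rfl

variable {f}

/-- The solutions form an ideal of `ℂ[s]`; a nonzero remainder modulo `b`, made monic, would
contradict minimality of the degree. -/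
theorem IsBFunction.functionalEq_iff_dvd {b c : ℂ[X]} (hb : IsBFunction n f b) :
    FunctionalEq n f c ↔ b ∣ c := by
  constructor
  · intro hc
    rw [← modByMonic_eq_zero_iff_dvd hb.1]
    by_contra hne
    have hmod : FunctionalEq n f (c %ₘ b) := by
      rw [← mem_functionalEqIdeal, modByMonic_eq_sub_mul_div]
      exact sub_mem hc (Ideal.mul_mem_right _ _ hb.2.1)
    have hlead : (c %ₘ b).leadingCoeff ≠ 0 := leadingCoeff_ne_zero.2 hne
    have h1 := hb.2.2 _ (monic_mul_leadingCoeff_inv hne)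
      (Ideal.mul_mem_right _ (functionalEqIdeal n f) hmod)
    rw [natDegree_mul_C (inv_ne_zero hlead)] at h1
    have h2 : b ≠ 1 := by
      rintro rfl
      exact hne (modByMonic_one c)
    exact absurd (natDegree_modByMonic_lt c hb.1 h2) (not_lt.2 h1)
  · rintro ⟨q, rfl⟩
    exact Ideal.mul_mem_right _ (functionalEqIdeal n f) hb.2.1

theorem isBFunction_bFunction {b : ℂ[X]} (hb0 : b ≠ 0) (hb : FunctionalEq n f b) :
    IsBFunction n f (bFunction n f) := by
  classical
  have hex : ∃ k, ∃ c : ℂ[X], c.Monic ∧ FunctionalEq n f c ∧ c.natDegree = k :=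
    ⟨_, _, monic_mul_leadingCoeff_inv hb0, Ideal.mul_mem_right _ (functionalEqIdeal n f) hb, rfl⟩
  have h : ∃ b, IsBFunction n f b := by
    obtain ⟨c, hc1, hc2, hc3⟩ := Nat.find_spec hex
    refine ⟨c, hc1, hc2, fun e he1 he2 => ?_⟩
    rw [hc3]
    exact Nat.find_min' hex ⟨e, he1, he2, rfl⟩
  rw [bFunction, dif_pos h]
  exact h.choose_spec

end Action

/-! ### Localization of the coefficients and clearing of denominators. -/

noncomputable section Functoriality

open Polynomial

variable {n : ℕ} {A : Type} [CommRing A] [Algebra ℂ A] [Partials n A] (S : Submonoid A)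

/-- The map of Weyl algebras induced by a localization of the coefficients. -/
def Weyl.locMap : Weyl n A →ₐ[ℂ] Weyl n (Localization S) :=
  RingQuot.liftAlgHom ℂ ⟨FreeAlgebra.lift ℂ (Sum.elim
    (fun a => Weyl.coef n (Localization S) (algebraMap A _ a)) (Weyl.del (Localization S))), by
    intro x y h
    induction h with
    | scalar c =>
      rw [FreeAlgebra.lift_ι_apply, AlgHom.commutes, Sum.elim_inl,
        ← IsScalarTower.algebraMap_apply, Weyl.coef_algebraMap]
    | add a b => simp
    | mul a b => simp
    | leibniz i a =>
      simp only [map_mul, map_add, FreeAlgebra.lift_ι_apply, Sum.elim_inl, Sum.elim_inr]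
      rw [Weyl.del_mul_coef]
      congr 2
      exact locDer_algebraMap S _ a
    | comm i j =>
      have := RingQuot.mkAlgHom_rel ℂ (WeylRel.comm (n := n) (A := Localization S) i j)
      simp only [map_mul] at this
      rw [map_mul, map_mul, FreeAlgebra.lift_ι_apply, FreeAlgebra.lift_ι_apply]
      exact this⟩

theorem Weyl.locMap_coef (a : A) : Weyl.locMap S (Weyl.coef n A a) =
    Weyl.coef n (Localization S) (algebraMap A _ a) := by
  change RingQuot.liftAlgHom ℂ _ (RingQuot.mkAlgHom ℂ _ _) = _
  rw [RingQuot.liftAlgHom_mkAlgHom_apply, FreeAlgebra.lift_ι_apply]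
  rfl

theorem Weyl.locMap_del (i : Fin n) :
    Weyl.locMap S (Weyl.del A i) = Weyl.del (Localization S) i := by
  rw [Weyl.locMap, Weyl.del, RingQuot.liftAlgHom_mkAlgHom_apply, FreeAlgebra.lift_ι_apply]
  rfl

variable (n) in
/-- The map `D[s] → (S⁻¹D)[s]`. -/
def locMapS : (Weyl n A)[X] →+* (Weyl n (Localization S))[X] :=
  mapRingHom (Weyl.locMap S).toRingHom

theorem locMapS_coefS (a : A) : locMapS n S (coefS n A a) =
    coefS n (Localization S) (algebraMap A _ a) := by
  rw [locMapS, coefS, RingHom.comp_apply, coe_mapRingHom, map_C]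
  exact congrArg C (Weyl.locMap_coef S a)

theorem locMapS_del (i : Fin n) : locMapS n S (C (Weyl.del A i)) =
    C (Weyl.del (Localization S) i) := by
  rw [locMapS, coe_mapRingHom, map_C]
  exact congrArg C (Weyl.locMap_del S i)

theorem locMapS_X : locMapS n S X = (X : (Weyl n (Localization S))[X]) := by
  rw [locMapS, coe_mapRingHom, map_X]

theorem locMapS_scalarS (c : ℂ[X]) :
    locMapS n S (scalarS n A c) = scalarS n (Localization S) c := by
  rw [locMapS, scalarS, scalarS, coe_mapRingHom, coe_mapRingHom, coe_mapRingHom, Polynomial.map_map]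
  congr 1
  ext c
  exact (Weyl.locMap S).commutes c

/-- Used with `a = h`, `d = ∂`, `b = ∂h`, `c = -∂h`: it is the identity `h² ∂ = h ∂ h - (∂h) h`,
which moves a denominator past a derivative. -/
theorem mul_mul_eq_of_commutator {R : Type*} [Semiring R] {a b c d : R} (h : d * a = a * d + b)
    (hc : a * b + c * a = 0) (r : R) : a * (d * (a * r)) + c * (a * r) = a * a * (d * r) := by
  calc a * (d * (a * r)) + c * (a * r) = a * (d * a) * r + c * a * r := by simp only [mul_assoc]
    _ = a * a * (d * r) + (a * b + c * a) * r := by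
      rw [h]
      simp only [mul_add, add_mul, mul_assoc, add_assoc]
    _ = _ := by rw [hc, zero_mul, add_zero]

/-- Denominators can be cleared on the left: functions contribute their denominators, and passing a
derivative only squares `h`. -/
theorem exists_coefS_mul_eq_locMapS (P : (Weyl n (Localization S))[X]) :
    ∃ h ∈ S, ∃ Q : (Weyl n A)[X],
      coefS n (Localization S) (algebraMap A _ h) * P = locMapS n S Q := by
  -- The extra right factor `R` makes the induction close under products: each generator is
  -- multiplied onto an operator whose denominator is already cleared on the left.
  suffices H : ∀ R : (Weyl n (Localization S))[X],
      (∃ h ∈ S, ∃ Q : (Weyl n A)[X],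
        coefS n (Localization S) (algebraMap A _ h) * R = locMapS n S Q) →
      ∃ h ∈ S, ∃ Q : (Weyl n A)[X],
        coefS n (Localization S) (algebraMap A _ h) * (P * R) = locMapS n S Q by
    simpa using H 1 ⟨1, S.one_mem, 1, by simp⟩
  induction P using weylS_induction with
  | coef b =>
    rintro R ⟨h, hh, Q, hQ⟩
    obtain ⟨⟨a, s⟩, hs⟩ := IsLocalization.surj S b
    refine ⟨s * h, S.mul_mem s.2 hh, coefS n A a * Q, ?_⟩
    have h1 : coefS n (Localization S) (algebraMap A _ (s * h)) * coefS n (Localization S) b =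
        coefS n (Localization S) (algebraMap A _ a) *
          coefS n (Localization S) (algebraMap A _ h) := by
      rw [← RingHom.map_mul, ← RingHom.map_mul, ← hs, RingHom.map_mul (algebraMap A _)]
      congr 1
      ring
    rw [RingHom.map_mul (locMapS n S), ← hQ, locMapS_coefS, ← mul_assoc, ← mul_assoc, h1]
  | del i =>
    rintro R ⟨h, hh, Q, hQ⟩
    refine ⟨h * h, S.mul_mem hh hh, coefS n A h * (C (Weyl.del A i) * Q) +
      coefS n A (-Partials.pd i h) * Q, ?_⟩
    have hdel : C (Weyl.del (Localization S) i) *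
        coefS n (Localization S) (algebraMap A _ h) =
        coefS n (Localization S) (algebraMap A _ h) * C (Weyl.del (Localization S) i) +
          coefS n (Localization S) (algebraMap A _ (Partials.pd i h)) := by
      have h1 : (Partials.pd i : Derivation ℂ (Localization S) _) (algebraMap A _ h) =
          algebraMap A _ (Partials.pd i h) := locDer_algebraMap S _ h
      simp only [coefS, RingHom.comp_apply]
      rw [← C_mul, Weyl.del_mul_coef, C_add, C_mul, h1]
    have hcancel : coefS n (Localization S) (algebraMap A _ h) *
          coefS n (Localization S) (algebraMap A _ (Partials.pd i h)) +
        coefS n (Localization S) (algebraMap A _ (-Partials.pd i h)) *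
          coefS n (Localization S) (algebraMap A _ h) = 0 := by
      have h1 : h * Partials.pd i h + -Partials.pd i h * h = 0 := by ring
      have h2 := congrArg (fun a => coefS n (Localization S) (algebraMap A _ a)) h1
      simpa only [map_add, map_mul, map_zero] using h2
    rw [RingHom.map_add, RingHom.map_mul (locMapS n S), RingHom.map_mul (locMapS n S),
      RingHom.map_mul (locMapS n S), ← hQ, locMapS_coefS,
      locMapS_del, locMapS_coefS, RingHom.map_mul, RingHom.map_mul]
    exact (mul_mul_eq_of_commutator hdel hcancel R).symm
  | var =>
    rintro R ⟨h, hh, Q, hQ⟩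
    refine ⟨h, hh, X * Q, ?_⟩
    rw [map_mul, ← hQ, locMapS_X, ← mul_assoc, ← mul_assoc, X_mul]
  | add P P' hP hP' =>
    intro R hR
    obtain ⟨h, hh, Q, hQ⟩ := hP R hR
    obtain ⟨h', hh', Q', hQ'⟩ := hP' R hR
    refine ⟨h * h', S.mul_mem hh hh', coefS n A h' * Q + coefS n A h * Q', ?_⟩
    rw [RingHom.map_add, RingHom.map_mul (locMapS n S), RingHom.map_mul (locMapS n S), ← hQ, ← hQ',
      locMapS_coefS, locMapS_coefS, add_mul, mul_add, ← mul_assoc (coefS n _ _) _ (P * R),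
      ← mul_assoc (coefS n _ _) _ (P' * R), ← RingHom.map_mul, ← RingHom.map_mul,
      ← RingHom.map_mul, ← RingHom.map_mul, mul_comm h' h]
  | mul P P' hP hP' =>
    intro R hR
    rw [mul_assoc]
    exact hP _ (hP' R hR)

variable (f : A)

/-- The map `A[1/f] → (S⁻¹A)[1/f]`. -/
def awayMap : Localization.Away f →+* Localization.Away (algebraMap A (Localization S) f) :=
  IsLocalization.Away.map (Localization.Away f)
    (Localization.Away (algebraMap A (Localization S) f)) (algebraMap A (Localization S)) f

theorem awayMap_algebraMap (a : A) : awayMap S f (algebraMap A _ a) =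
    algebraMap (Localization S) _ (algebraMap A _ a) := by
  rw [awayMap, IsLocalization.Away.map, IsLocalization.map_eq]

theorem awayMap_invSelf : awayMap S f (IsLocalization.Away.invSelf f) =
    IsLocalization.Away.invSelf (algebraMap A (Localization S) f) := by
  have h1 := congrArg (awayMap S f) (IsLocalization.Away.mul_invSelf (S := Localization.Away f) f)
  rw [map_mul, map_one, awayMap_algebraMap] at h1
  have h2 := IsLocalization.Away.mul_invSelf
    (S := Localization.Away (algebraMap A (Localization S) f)) (algebraMap A (Localization S) f)
  linear_combination (IsLocalization.Away.invSelf (algebraMap A (Localization S) f)) * h1 -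
    awayMap S f (IsLocalization.Away.invSelf f) * h2

/-- Differentiating `b s = a` before and after the map gives two equations that differ only in the
derivative of `b`, and the image of `s` is a unit. -/
theorem awayMap_pd (i : Fin n) (b : Localization.Away f) :
    awayMap S f (Partials.pd i b) = Partials.pd i (awayMap S f b) := by
  obtain ⟨⟨a, s⟩, hs⟩ := IsLocalization.surj (Submonoid.powers f) b
  have hA : ∀ a : A, (Partials.pd i : Derivation ℂ (Localization.Away f) _) (algebraMap A _ a) =
      algebraMap A _ (Partials.pd i a) := fun a => locDer_algebraMap _ _ a
  have hB : ∀ a : A, (Partials.pd i :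
      Derivation ℂ (Localization.Away (algebraMap A (Localization S) f)) _)
      (awayMap S f (algebraMap A _ a)) = awayMap S f (algebraMap A _ (Partials.pd i a)) := by
    intro a
    rw [awayMap_algebraMap, awayMap_algebraMap]
    refine (locDer_algebraMap _ _ _).trans (congrArg _ ?_)
    exact locDer_algebraMap _ _ _
  have h1 := congrArg (fun t => awayMap S f (Partials.pd i t)) hs
  have h2 := congrArg (fun t => Partials.pd i (awayMap S f t)) hs
  simp only [map_mul, Derivation.leibniz, smul_eq_mul, hA, hB, map_add] at h1 h2
  have hu : IsUnit (awayMap S f (algebraMap A _ s)) :=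
    (IsLocalization.map_units (Localization.Away f) s).map _
  apply hu.mul_left_cancel
  linear_combination h1 - h2

/-- The map `A[s, 1/f] · f^s → (S⁻¹A)[s, 1/f] · f^s`. -/
def powMap : PowModule f →+* PowModule (algebraMap A (Localization S) f) :=
  mapRingHom (awayMap S f)

theorem powMap_C (b : Localization.Away f) : powMap S f (C b) = C (awayMap S f b) := by
  rw [powMap, coe_mapRingHom, map_C]

theorem powMap_act (P : (Weyl n A)[X]) (g : PowModule f) :
    powMap S f (act n f P g) =
      act n (algebraMap A (Localization S) f) (locMapS n S P) (powMap S f g) := by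
  induction P using weylS_induction generalizing g with
  | coef a => rw [locMapS_coefS, act_coefS, act_coefS, map_mul, powMap_C, awayMap_algebraMap]
  | del i =>
    have h1 : powMap S f (coeffDer (Partials.pd i) g) =
        coeffDer (Partials.pd i) (powMap S f g) := by
      ext k
      simp only [powMap, coe_mapRingHom, coeff_map, coeff_coeffDer, awayMap_pd]
    have h2 : powMap S f (logTerm n f i) = logTerm n (algebraMap A (Localization S) f) i := by
      have hX : powMap S f X = X := by rw [powMap, coe_mapRingHom, map_X]
      rw [logTerm, logTerm, map_mul, hX, powMap_C, map_mul, awayMap_algebraMap, awayMap_invSelf]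
      congr 3
      exact congrArg _ (locDer_algebraMap S _ f).symm
    rw [locMapS_del, act_del, act_del, pdAct_apply, pdAct_apply, map_add, map_mul, h1, h2]
  | var =>
    have hX : powMap S f X = X := by rw [powMap, coe_mapRingHom, map_X]
    rw [locMapS_X, act_X, act_X, map_mul, hX]
  | add P Q hP hQ => rw [act_add, RingHom.map_add, RingHom.map_add, act_add, hP, hQ]
  | mul P Q hP hQ => rw [RingHom.map_mul (locMapS n S), act_mul, act_mul, hP, hQ]

theorem powMap_injective (hS : S ≤ nonZeroDivisors A) : Function.Injective (powMap S f) := by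
  apply Polynomial.map_injective
  rw [injective_iff_map_eq_zero]
  intro b hb
  obtain ⟨⟨a, s⟩, hs⟩ := IsLocalization.surj (Submonoid.powers f) b
  have h1 := congrArg (awayMap S f) hs
  rw [map_mul, hb, zero_mul, awayMap_algebraMap, eq_comm,
    IsLocalization.map_eq_zero_iff (Submonoid.powers (algebraMap A (Localization S) f))] at h1
  obtain ⟨⟨_, k, rfl⟩, hk⟩ := h1
  simp only at hk hs
  rw [← map_pow, ← map_mul] at hk
  have h2 := IsLocalization.injective (Localization S) hS (hk.trans (map_zero _).symm)
  apply (IsLocalization.map_units (Localization.Away f) s).mul_left_eq_zero.1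
  rw [hs, IsLocalization.map_eq_zero_iff (Submonoid.powers f)]
  exact ⟨⟨_, k, rfl⟩, h2⟩

theorem locMapS_mem_bIdeal {P : (Weyl n A)[X]} (hP : P ∈ bIdeal n f) :
    locMapS n S P ∈ bIdeal n (algebraMap A (Localization S) f) := by
  rw [mem_bIdeal] at hP ⊢
  obtain ⟨Q, hQ⟩ := hP
  refine ⟨locMapS n S Q, ?_⟩
  have h1 := congrArg (powMap S f) hQ
  have hfs : powMap S f (fs f) = fs (algebraMap A (Localization S) f) := map_one _
  rwa [powMap_act, powMap_act, RingHom.map_mul (locMapS n S), locMapS_coefS, hfs] at h1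

/-- If `P f^s = Q f · f^s` locally and `h Q` comes from a global `R`, then `h P f^s = R f · f^s`
holds locally, hence globally because localizing at nonzerodivisors is injective on these modules.
-/
theorem exists_coefS_mul_mem_bIdeal (hS : S ≤ nonZeroDivisors A) {P : (Weyl n A)[X]}
    (hP : locMapS n S P ∈ bIdeal n (algebraMap A (Localization S) f)) :
    ∃ h ∈ S, coefS n A h * P ∈ bIdeal n f := by
  rw [mem_bIdeal] at hP
  obtain ⟨Q, hQ⟩ := hP
  obtain ⟨h, hh, R, hR⟩ := exists_coefS_mul_eq_locMapS S Q
  refine ⟨h, hh, (mem_bIdeal f).2 ⟨R, powMap_injective S f hS ?_⟩⟩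
  have hfs : powMap S f (fs f) = fs (algebraMap A (Localization S) f) := map_one _
  rw [powMap_act, powMap_act, RingHom.map_mul (locMapS n S), RingHom.map_mul (locMapS n S),
    locMapS_coefS, locMapS_coefS, hfs, ← hR, act_mul,
    hQ, mul_assoc, act_mul _ (coefS n (Localization S) _)]

end Functoriality

/-- A `k`-basis of `S` still spans after extending scalars to `K`. This transfers dimension counts
from `ℂ` to `ℂ(s)`. -/
theorem finrank_span_image_le {k K W M : Type*} [Field k] [Field K] [Algebra k K]
    [AddCommGroup W] [Module k W] [AddCommGroup M] [Module k M] [Module K M] [IsScalarTower k K M]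
    (e : W →ₗ[k] M) (S : Submodule k W) [FiniteDimensional k S] :
    FiniteDimensional K (Submodule.span K (e '' S)) ∧
      Module.finrank K (Submodule.span K (e '' S)) ≤ Module.finrank k S := by
  set b := Module.finBasis k S
  have hspan : Submodule.span K (e '' S) = Submodule.span K (Set.range fun i => e (b i)) := by
    apply le_antisymm
    · rw [Submodule.span_le]
      rintro _ ⟨w, hw, rfl⟩
      have h1 := congrArg Subtype.val (b.sum_repr ⟨w, hw⟩)
      rw [Submodule.coe_sum] at h1
      simp only [Submodule.coe_smul] at h1
      rw [← h1, map_sum]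
      refine Submodule.sum_mem _ fun i _ => ?_
      rw [map_smul, ← algebraMap_smul K]
      exact Submodule.smul_mem _ _ (Submodule.subset_span ⟨i, rfl⟩)
    · apply Submodule.span_mono
      rintro _ ⟨i, rfl⟩
      exact ⟨b i, (b i).2, rfl⟩
  rw [hspan]
  refine ⟨FiniteDimensional.span_of_finite K (Set.finite_range _), ?_⟩
  refine (finrank_range_le_card _).trans ?_
  rw [Fintype.card_fin]

/-! ### Polynomials with bounded degree in each variable. -/

section Degree

open MvPolynomial

variable {σ : Type*}

theorem mem_restrictDegree_iff_degreeOf {p : MvPolynomial σ ℂ} {k : ℕ} :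
    p ∈ restrictDegree σ ℂ k ↔ ∀ i, degreeOf i p ≤ k := by
  rw [mem_restrictDegree]
  simp only [degreeOf_le_iff]
  exact ⟨fun h i m hm => h m hm i, fun h m hm i => h i m hm⟩

theorem mul_mem_restrictDegree {p q : MvPolynomial σ ℂ} {k l : ℕ} (hp : p ∈ restrictDegree σ ℂ k)
    (hq : q ∈ restrictDegree σ ℂ l) : p * q ∈ restrictDegree σ ℂ (k + l) := by
  rw [mem_restrictDegree_iff_degreeOf] at *
  exact fun i => (degreeOf_mul_le i p q).trans (add_le_add (hp i) (hq i))

theorem restrictDegree_mono {k l : ℕ} (h : k ≤ l) {p : MvPolynomial σ ℂ}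
    (hp : p ∈ restrictDegree σ ℂ k) : p ∈ restrictDegree σ ℂ l := by
  rw [mem_restrictDegree_iff_degreeOf] at *
  exact fun i => (hp i).trans h

theorem pderiv_mem_restrictDegree {p : MvPolynomial σ ℂ} {k : ℕ}
    (hp : p ∈ restrictDegree σ ℂ k) (i : σ) : pderiv i p ∈ restrictDegree σ ℂ k := by
  rw [mem_restrictDegree] at *
  intro m hm j
  rw [mem_support_iff, coeff_pderiv] at hm
  refine le_trans ?_ (hp _ (mem_support_iff.2 (left_ne_zero_of_mul hm)) j)
  rw [Finsupp.add_apply]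
  exact Nat.le_add_right _ _

theorem X_mem_restrictDegree (i : σ) : (X i : MvPolynomial σ ℂ) ∈ restrictDegree σ ℂ 1 := by
  rw [mem_restrictDegree_iff_degreeOf]
  exact fun j => (degreeOf_le_totalDegree _ _).trans (totalDegree_X i).le

theorem mem_restrictDegree_totalDegree (p : MvPolynomial σ ℂ) :
    p ∈ restrictDegree σ ℂ p.totalDegree :=
  mem_restrictDegree_iff_degreeOf.2 fun i => degreeOf_le_totalDegree p i

end Degree

/-! ### The module over the field `ℂ(s)` and the chain generated by powers of `f`. -/

noncomputable section GenericModule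

open Polynomial TensorProduct

attribute [local instance] Polynomial.algebra

variable {n : ℕ} {A : Type} [CommRing A] [Algebra ℂ A] [Partials n A] (f : A)

theorem smul_powModule (c : ℂ[X]) (g : PowModule f) :
    c • g = c.map (algebraMap ℂ (Localization.Away f)) * g :=
  Algebra.smul_def c g

/-- The action of an element of `D[s]`, as a `ℂ[s]`-linear map. -/
def actLin (P : (Weyl n A)[X]) : PowModule f →ₗ[ℂ[X]] PowModule f where
  toFun := act n f P
  map_add' := map_add _
  map_smul' c g := by
    rw [RingHom.id_apply, smul_powModule, smul_powModule, ← act_scalarS (n := n) f,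
      ← act_scalarS (n := n) f, ← act_mul, ← act_mul, (scalarS_comm c P).eq]

/-- The module `ℂ(s) ⊗ A[s, 1/f] · f^s`. -/
abbrev GenModule : Type := FractionRing ℂ[X] ⊗[ℂ[X]] PowModule f

/-- The canonical map from `A[s, 1/f] · f^s` to `ℂ(s) ⊗ A[s, 1/f] · f^s`. -/
def toGen : PowModule f →ₗ[ℂ[X]] GenModule f :=
  TensorProduct.mk ℂ[X] (FractionRing ℂ[X]) (PowModule f) 1

instance : IsLocalizedModule (nonZeroDivisors ℂ[X]) (toGen f) :=
  inferInstanceAs (IsLocalizedModule _ (TensorProduct.mk ℂ[X] (FractionRing ℂ[X]) (PowModule f) 1))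

/-- The action of an element of `D[s]` on `ℂ(s) ⊗ A[s, 1/f] · f^s`. -/
def genOp (P : (Weyl n A)[X]) : Module.End (FractionRing ℂ[X]) (GenModule f) :=
  (actLin f P).baseChange (FractionRing ℂ[X])

theorem genOp_toGen (P : (Weyl n A)[X]) (g : PowModule f) :
    genOp f P (toGen f g) = toGen f (act n f P g) :=
  LinearMap.baseChange_tmul _ _ _

theorem genModule_hom_ext {T U : Module.End (FractionRing ℂ[X]) (GenModule f)}
    (h : ∀ g, T (toGen f g) = U (toGen f g)) : T = U :=
  TensorProduct.AlgebraTensorModule.curry_injective (by ext g; exact h g)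

theorem genOp_mul (P Q : (Weyl n A)[X]) : genOp f (P * Q) = genOp f P * genOp f Q := by
  refine genModule_hom_ext f fun g => ?_
  rw [Module.End.mul_apply, genOp_toGen, genOp_toGen, genOp_toGen, act_mul]

theorem C_del_mul_C_del_comm (i j : Fin n) : C (Weyl.del A i) * C (Weyl.del A j) =
    C (Weyl.del A j) * C (Weyl.del A i) := by
  have := RingQuot.mkAlgHom_rel ℂ (WeylRel.comm (n := n) (A := A) i j)
  rw [map_mul, map_mul] at this
  rw [← C_mul, ← C_mul]
  exact congrArg C this

variable (n) in
/-- The `ℂ(s)`-submodule generated by `D[s] f^k · f^s`. -/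
def genChain (k : ℕ) : Submodule (FractionRing ℂ[X]) (GenModule f) :=
  Submodule.span _ (Set.range fun P : (Weyl n A)[X] =>
    toGen f (act n f P (C (algebraMap A (Localization.Away f) f ^ k))))

theorem genOp_mem_genChain (P : (Weyl n A)[X]) (k : ℕ) {g : GenModule f}
    (hg : g ∈ genChain n f k) : genOp f P g ∈ genChain n f k := by
  refine Submodule.span_induction (p := fun g _ => genOp f P g ∈ genChain n f k) ?_ ?_ ?_ ?_ hg
  · rintro _ ⟨Q, rfl⟩
    rw [genOp_toGen, ← act_mul]
    exact Submodule.subset_span ⟨P * Q, rfl⟩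
  · rw [map_zero]; exact zero_mem _
  · intro a b _ _ ha hb; rw [map_add]; exact add_mem ha hb
  · intro c a _ ha; rw [map_smul]; exact Submodule.smul_mem _ _ ha

theorem toGen_mem_genChain (k : ℕ) :
    toGen f (C (algebraMap A (Localization.Away f) f ^ k)) ∈ genChain n f k :=
  Submodule.subset_span ⟨1, by simp⟩

theorem genChain_antitone : Antitone (genChain n f) := by
  apply antitone_nat_of_succ_le
  intro k
  rw [genChain, Submodule.span_le]
  rintro _ ⟨P, rfl⟩
  refine Submodule.subset_span ⟨P * coefS n A f, ?_⟩
  change toGen f (act n f (P * coefS n A f) _) = toGen f (act n f P _)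
  rw [act_mul, act_coefS, ← C_mul, ← pow_succ']

/-- Membership over `ℂ(s)` becomes membership over `ℂ[s]` after multiplication by a nonzero
polynomial, the common denominator `b`. -/
theorem exists_act_pow_succ {k : ℕ}
    (h : toGen f (C (algebraMap A (Localization.Away f) f ^ k)) ∈ genChain n f (k + 1)) :
    ∃ b : ℂ[X], b ≠ 0 ∧ ∃ P : (Weyl n A)[X],
      act n f P (C (algebraMap A (Localization.Away f) f ^ (k + 1))) =
        b.map (algebraMap ℂ (Localization.Away f)) *
          C (algebraMap A (Localization.Away f) f ^ k) := by
  let N : Submodule ℂ[X] (PowModule f) :=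
    { carrier := Set.range fun P : (Weyl n A)[X] =>
        act n f P (C (algebraMap A (Localization.Away f) f ^ (k + 1)))
      add_mem' := by
        rintro _ _ ⟨P, rfl⟩ ⟨Q, rfl⟩
        exact ⟨P + Q, act_add _ _ _ _⟩
      zero_mem' := ⟨0, by simp⟩
      smul_mem' := by
        rintro c _ ⟨P, rfl⟩
        refine ⟨scalarS n A c * P, ?_⟩
        rw [smul_powModule]
        exact (act_mul _ _ _ _).trans (act_scalarS _ _ _) }
  -- The span over `ℂ(s)` is the localization of `D[s] f^(k+1) f^s` at the nonzero polynomials, so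
  -- its elements are single fractions `m / s`.
  have h1 : genChain n f (k + 1) =
      N.localized' (FractionRing ℂ[X]) (nonZeroDivisors ℂ[X]) (toGen f) := by
    rw [Submodule.localized'_eq_span, genChain]
    congr 1
    ext y
    simp [N]
  rw [h1, Submodule.mem_localized'] at h
  obtain ⟨m, ⟨P, hP⟩, s, hs⟩ := h
  rw [IsLocalizedModule.mk'_eq_iff] at hs
  have hs' : toGen f m = toGen f ((s : ℂ[X]) • C (algebraMap A (Localization.Away f) f ^ k)) := by
    rw [map_smul]
    exact hs
  obtain ⟨c, hc⟩ := IsLocalizedModule.exists_of_eq (S := nonZeroDivisors ℂ[X]) hs'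
  refine ⟨c * s, nonZeroDivisors.coe_ne_zero (c * s), scalarS n A c * P, ?_⟩
  rw [act_mul, act_scalarS, Polynomial.map_mul, mul_assoc, ← smul_powModule, ← smul_powModule,
    ← smul_powModule]
  exact (congrArg _ hP).trans hc

end GenericModule

/-! ### The substitution `s ↦ s - k`. -/

noncomputable section Shift

open Polynomial

variable {n : ℕ} {A : Type} [CommRing A] [Algebra ℂ A] [Partials n A] (f : A)

/-- The substitution `s ↦ s - k` on `A[s, 1/f] · f^s`. -/
def shiftHom (k : ℕ) : PowModule f →+* PowModule f :=
  compRingHom (X - C (k : Localization.Away f))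

/-- The action of `s ↦ s - k` on `A[s, 1/f] · f^s`, with `f^(s-k)` expanded as `f^(-k) f^s`. -/
def shiftPow (k : ℕ) (g : PowModule f) : PowModule f :=
  C (IsLocalization.Away.invSelf f ^ k) * shiftHom f k g

theorem shiftHom_X (k : ℕ) : shiftHom f k X = X - C (k : Localization.Away f) :=
  X_comp

theorem shiftHom_C (k : ℕ) (b : Localization.Away f) : shiftHom f k (C b) = C b :=
  C_comp

theorem pd_algebraMap_away (i : Fin n) (a : A) :
    (Partials.pd i : Derivation ℂ (Localization.Away f) _) (algebraMap A _ a) =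
      algebraMap A _ (Partials.pd i a) :=
  locDer_algebraMap _ _ a

theorem pd_invSelf (i : Fin n) :
    (Partials.pd i : Derivation ℂ (Localization.Away f) _) (IsLocalization.Away.invSelf f) =
      - (IsLocalization.Away.invSelf f ^ 2 * algebraMap A _ (Partials.pd i f)) := by
  have hinv : algebraMap A (Localization.Away f) f *
      IsLocalization.Away.invSelf (S := Localization.Away f) f = 1 :=
    IsLocalization.Away.mul_invSelf f
  have h := congrArg (Partials.pd i : Derivation ℂ (Localization.Away f) _) hinv
  rw [Derivation.leibniz, pd_algebraMap_away, Derivation.map_one_eq_zero, smul_eq_mul,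
    smul_eq_mul] at h
  linear_combination IsLocalization.Away.invSelf f * h -
    (Partials.pd i : Derivation ℂ (Localization.Away f) _) (IsLocalization.Away.invSelf f) * hinv

theorem pd_invSelf_pow (i : Fin n) (k : ℕ) :
    (Partials.pd i : Derivation ℂ (Localization.Away f) _) (IsLocalization.Away.invSelf f ^ k) =
      - (k * IsLocalization.Away.invSelf f ^ (k + 1) * algebraMap A _ (Partials.pd i f)) := by
  rw [Derivation.leibniz_pow, pd_invSelf]
  rcases k with _ | k
  · simp
  · simp only [nsmul_eq_mul, smul_eq_mul, Nat.add_sub_cancel]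
    ring

theorem coeffDer_comp_X_sub_C {B : Type} [CommRing B] [Algebra ℂ B] (d : Derivation ℂ B B) (k : ℕ)
    (g : B[X]) : coeffDer d (g.comp (X - C (k : B))) = (coeffDer d g).comp (X - C (k : B)) := by
  induction g using Polynomial.induction_on' with
  | add p q hp hq => rw [add_comp, map_add, map_add, add_comp, hp, hq]
  | monomial m b =>
    have h1 : coeffDer d (monomial m b) = monomial m (d b) := by
      ext j
      rw [coeff_coeffDer, coeff_monomial, coeff_monomial]
      split_ifs <;> simp
    rw [h1, monomial_comp, monomial_comp, Derivation.leibniz, Derivation.leibniz_pow, map_sub,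
      coeffDer_X, coeffDer_C, coeffDer_C, Derivation.map_natCast]
    simp [mul_comm]

/-- The substitution intertwines `P(s)` with `P(s - k)`. For `∂ᵢ` nothing changes: differentiating
`f^(-k)` yields `-k (∂ᵢf)/f`, exactly the change of the logarithmic term under `s ↦ s - k`. -/
theorem exists_act_shiftPow (k : ℕ) (P : (Weyl n A)[X]) :
    ∃ Q : (Weyl n A)[X], ∀ g, shiftPow f k (act n f P g) = act n f Q (shiftPow f k g) := by
  induction P using weylS_induction with
  | coef a =>
    refine ⟨coefS n A a, fun g => ?_⟩
    rw [act_coefS, act_coefS, shiftPow, shiftPow, map_mul, shiftHom_C]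
    ring
  | del i =>
    refine ⟨C (Weyl.del A i), fun g => ?_⟩
    have h1 : coeffDer (Partials.pd i) (shiftHom f k g) =
        shiftHom f k (coeffDer (Partials.pd i) g) := coeffDer_comp_X_sub_C _ k g
    have h2 : shiftHom f k (logTerm n f i) = logTerm n f i -
        C ((k : Localization.Away f) *
          (algebraMap A _ (Partials.pd i f) * IsLocalization.Away.invSelf f)) := by
      rw [logTerm, map_mul, shiftHom_X, shiftHom_C, C_mul (a := (k : Localization.Away f))]
      ring
    rw [act_del, act_del, pdAct_apply, pdAct_apply, shiftPow, shiftPow, map_add, map_mul, h2,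
      Derivation.leibniz, h1, coeffDer_C, pd_invSelf_pow]
    simp only [smul_eq_mul, C_neg, C_mul, C_pow]
    ring
  | var =>
    refine ⟨X + coefS n A (-k), fun g => ?_⟩
    rw [act_X, act_add, act_X, act_coefS, shiftPow, shiftPow, map_mul, shiftHom_X]
    simp only [map_neg, map_natCast]
    ring
  | add P P' hP hP' =>
    obtain ⟨Q, hQ⟩ := hP
    obtain ⟨Q', hQ'⟩ := hP'
    refine ⟨Q + Q', fun g => ?_⟩
    rw [act_add, act_add, ← hQ, ← hQ', shiftPow, shiftPow, shiftPow, map_add, mul_add]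
  | mul P P' hP hP' =>
    obtain ⟨Q, hQ⟩ := hP
    obtain ⟨Q', hQ'⟩ := hP'
    refine ⟨Q * Q', fun g => ?_⟩
    rw [act_mul, act_mul, hQ, hQ']

/-- Substituting `s - k` for `s` turns `f^(k+1) f^s` into `f · f^s` and `f^k f^s` into `f^s`. -/
theorem functionalEq_of_act_pow_succ {k : ℕ} {b : ℂ[X]} {P : (Weyl n A)[X]}
    (h : act n f P (C (algebraMap A (Localization.Away f) f ^ (k + 1))) =
        b.map (algebraMap ℂ (Localization.Away f)) *
          C (algebraMap A (Localization.Away f) f ^ k)) :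
    FunctionalEq n f (b.comp (X - C (k : ℂ))) := by
  obtain ⟨Q, hQ⟩ := exists_act_shiftPow f k P
  have hinv : algebraMap A (Localization.Away f) f *
      IsLocalization.Away.invSelf (S := Localization.Away f) f = 1 :=
    IsLocalization.Away.mul_invSelf f
  have hpow : IsLocalization.Away.invSelf (S := Localization.Away f) f ^ k *
      algebraMap A (Localization.Away f) f ^ k = 1 := by
    rw [← mul_pow, mul_comm, hinv, one_pow]
  have h1 := hQ (C (algebraMap A (Localization.Away f) f ^ (k + 1)))
  rw [h, shiftPow, shiftPow, map_mul, shiftHom_C, shiftHom_C, mul_left_comm, ← C_mul, ← C_mul,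
    pow_succ, ← mul_assoc, hpow, one_mul, C_1, mul_one] at h1
  refine ⟨Q, ?_⟩
  rw [act_mul, act_coefS, fs, mul_one, ← h1, mul_one, map_comp, Polynomial.map_sub, map_X, map_C,
    map_natCast]
  rfl

end Shift

/-! ### The filtration by pole order and the existence of `b`-functions. -/

noncomputable section Existence

open Polynomial TensorProduct

attribute [local instance] Polynomial.algebra

variable {n : ℕ} (f : MvPolynomial (Fin n) ℂ)

theorem weylAction_genOp : WeylAction
    (fun i : Fin n => genOp (n := n) f (coefS n (MvPolynomial (Fin n) ℂ) (MvPolynomial.X i)))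
    (fun i => genOp f (C (Weyl.del (MvPolynomial (Fin n) ℂ) i))) where
  x_comm i j := by
    rw [Commute, SemiconjBy, ← genOp_mul, ← genOp_mul, ← map_mul, ← map_mul, mul_comm]
  d_comm i j := by
    rw [Commute, SemiconjBy, ← genOp_mul, ← genOp_mul, C_del_mul_C_del_comm]
  d_x i j := by
    have h1 : C (Weyl.del (MvPolynomial (Fin n) ℂ) i) *
        coefS n (MvPolynomial (Fin n) ℂ) (MvPolynomial.X j) =
        coefS n (MvPolynomial (Fin n) ℂ) (MvPolynomial.X j) *
          C (Weyl.del (MvPolynomial (Fin n) ℂ) i) +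
        coefS n (MvPolynomial (Fin n) ℂ) (MvPolynomial.pderiv i (MvPolynomial.X j)) := by
      simp only [coefS, RingHom.comp_apply]
      rw [← C_mul, Weyl.del_mul_coef, C_add, C_mul]
      rfl
    refine genModule_hom_ext f fun g => ?_
    rw [LinearMap.sub_apply, Module.End.mul_apply, Module.End.mul_apply, genOp_toGen, genOp_toGen,
      genOp_toGen, genOp_toGen, ← map_sub, ← act_mul, h1, act_add, act_mul, add_sub_cancel_left,
      MvPolynomial.pderiv_X, Pi.single_apply, act_coefS]
    split_ifs with h2 h3 h3
    · simp
    · exact absurd h2.symm h3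
    · exact absurd h3.symm h2
    · simp

/-- The map `g ↦ g f^(-v) · f^s`. -/
def fracMap (v : ℕ) : MvPolynomial (Fin n) ℂ →ₗ[ℂ] GenModule f where
  toFun g := toGen f (C (algebraMap _ (Localization.Away f) g * IsLocalization.Away.invSelf f ^ v))
  map_add' a b := by rw [map_add, add_mul, C_add, map_add]
  map_smul' c a := by
    have h1 : C (algebraMap _ (Localization.Away f) (c • a) * IsLocalization.Away.invSelf f ^ v) =
        (C c : ℂ[X]) •
          (C (algebraMap _ (Localization.Away f) a * IsLocalization.Away.invSelf f ^ v) :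
            PowModule f) := by
      rw [smul_powModule, map_C, ← C_mul, Algebra.smul_def,
        RingHom.map_mul (algebraMap (MvPolynomial (Fin n) ℂ) _), mul_assoc,
        ← IsScalarTower.algebraMap_apply]
    rw [h1, map_smul, RingHom.id_apply]
    exact algebraMap_smul ℂ[X] c _

theorem fracMap_apply (v : ℕ) (g : MvPolynomial (Fin n) ℂ) : fracMap f v g =
    toGen f (C (algebraMap _ (Localization.Away f) g * IsLocalization.Away.invSelf f ^ v)) := rfl

/-- The filtration of `ℂ(s) ⊗ ℂ[x][s, 1/f] · f^s` by the degree of the numerator and the order of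
the denominator. -/
def genFil (v : ℕ) : Submodule (FractionRing ℂ[X]) (GenModule f) :=
  Submodule.span _ (fracMap f v ''
    MvPolynomial.restrictDegree (Fin n) ℂ ((f.totalDegree + 1) * v))

theorem fracMap_mem {v : ℕ} {g : MvPolynomial (Fin n) ℂ}
    (hg : g ∈ MvPolynomial.restrictDegree (Fin n) ℂ ((f.totalDegree + 1) * v)) :
    fracMap f v g ∈ genFil f v :=
  Submodule.subset_span ⟨g, hg, rfl⟩

theorem fracMap_mul_self (v : ℕ) (g : MvPolynomial (Fin n) ℂ) :
    fracMap f (v + 1) (f * g) = fracMap f v g := by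
  have hinv : algebraMap _ (Localization.Away f) f *
      IsLocalization.Away.invSelf (S := Localization.Away f) f = 1 :=
    IsLocalization.Away.mul_invSelf f
  change toGen f (C _) = toGen f (C _)
  congr 2
  rw [map_mul, pow_succ]
  linear_combination (algebraMap _ (Localization.Away f) g * IsLocalization.Away.invSelf f ^ v) *
    hinv

theorem genFil_monotone : Monotone (genFil f) := by
  apply monotone_nat_of_le_succ
  intro v
  rw [genFil, Submodule.span_le]
  rintro _ ⟨g, hg, rfl⟩
  rw [← fracMap_mul_self]
  refine fracMap_mem f (restrictDegree_mono ?_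
    (mul_mem_restrictDegree (mem_restrictDegree_totalDegree f) hg))
  rw [mul_add]
  omega

theorem genOp_mem_genFil {P : (Weyl n (MvPolynomial (Fin n) ℂ))[X]} {v : ℕ}
    (h : ∀ g ∈ MvPolynomial.restrictDegree (Fin n) ℂ ((f.totalDegree + 1) * v),
      genOp f P (fracMap f v g) ∈ genFil f (v + 1)) {g : GenModule f} (hg : g ∈ genFil f v) :
    genOp f P g ∈ genFil f (v + 1) := by
  refine Submodule.span_induction (p := fun g _ => genOp f P g ∈ genFil f (v + 1)) ?_ ?_ ?_ ?_ hg
  · rintro _ ⟨g, hg, rfl⟩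
    exact h g hg
  · rw [map_zero]; exact zero_mem _
  · intro a b _ _ ha hb; rw [map_add]; exact add_mem ha hb
  · intro c a _ ha; rw [map_smul]; exact Submodule.smul_mem _ _ ha

/-- Rewriting `xᵢ g f^(-v)` as `(f xᵢ g) f^(-v-1)` raises the numerator degree by at most `deg f +
1`, which explains the slope of the filtration. -/
theorem genOp_X_mem_genFil (i : Fin n) (v : ℕ) {g : GenModule f} (hg : g ∈ genFil f v) :
    genOp f (coefS n (MvPolynomial (Fin n) ℂ) (MvPolynomial.X i)) g ∈ genFil f (v + 1) := by
  refine genOp_mem_genFil f (fun g hg => ?_) hg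
  rw [fracMap_apply, genOp_toGen, act_coefS, ← C_mul, ← mul_assoc,
    ← map_mul]
  change fracMap f v (MvPolynomial.X i * g) ∈ _
  rw [← fracMap_mul_self]
  refine fracMap_mem f (restrictDegree_mono ?_ (mul_mem_restrictDegree
    (mem_restrictDegree_totalDegree f) (mul_mem_restrictDegree (X_mem_restrictDegree i) hg)))
  rw [mul_add]
  omega

/-- By the quotient rule the new numerator over `f^(v+1)` is `f ∂ᵢg - v g ∂ᵢf + s g ∂ᵢf`, and `s` is
a scalar in `ℂ(s)`. -/
theorem genOp_del_mem_genFil (i : Fin n) (v : ℕ) {g : GenModule f} (hg : g ∈ genFil f v) :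
    genOp f (C (Weyl.del (MvPolynomial (Fin n) ℂ) i)) g ∈ genFil f (v + 1) := by
  refine genOp_mem_genFil f (fun g hg => ?_) hg
  have hinv : algebraMap _ (Localization.Away f) f *
      IsLocalization.Away.invSelf (S := Localization.Away f) f = 1 :=
    IsLocalization.Away.mul_invSelf f
  have hderiv : (Partials.pd i : Derivation ℂ (Localization.Away f) _)
      (algebraMap _ (Localization.Away f) g * IsLocalization.Away.invSelf f ^ v) =
      algebraMap _ (Localization.Away f) (f * MvPolynomial.pderiv i g +
        (-v : ℂ) • (MvPolynomial.pderiv i f * g)) * IsLocalization.Away.invSelf f ^ (v + 1) := by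
    have h1 : (Partials.pd i : Derivation ℂ (Localization.Away f) _) (algebraMap _ _ g) =
        algebraMap _ _ (MvPolynomial.pderiv i g) := pd_algebraMap_away f i g
    have h2 : algebraMap _ (Localization.Away f)
        ((Partials.pd i : Derivation ℂ (MvPolynomial (Fin n) ℂ) _) f) =
        algebraMap _ _ (MvPolynomial.pderiv i f) := rfl
    have h3 : (-v : ℂ) • (MvPolynomial.pderiv i f * g) =
        -(v * (MvPolynomial.pderiv i f * g)) := by
      rw [neg_smul, Nat.cast_smul_eq_nsmul, nsmul_eq_mul]
    rw [Derivation.leibniz, pd_invSelf_pow, h1, h2, h3]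
    simp only [smul_eq_mul, map_add, map_neg, map_mul, map_natCast]
    linear_combination (-(algebraMap _ (Localization.Away f) (MvPolynomial.pderiv i g) *
      IsLocalization.Away.invSelf f ^ v)) * hinv
  have hact : genOp f (C (Weyl.del (MvPolynomial (Fin n) ℂ) i)) (fracMap f v g) =
      fracMap f (v + 1) (f * MvPolynomial.pderiv i g +
        (-v : ℂ) • (MvPolynomial.pderiv i f * g)) +
      algebraMap ℂ[X] (FractionRing ℂ[X]) X •
        fracMap f (v + 1) (MvPolynomial.pderiv i f * g) := by
    rw [fracMap_apply, genOp_toGen, act_del, pdAct_apply, coeffDer_C,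
      hderiv, map_add, algebraMap_smul]
    congr 1
    change _ = X • toGen f (C _)
    rw [← map_smul, smul_powModule, map_X, logTerm, mul_assoc, ← C_mul]
    congr 3
    rw [map_mul, pow_succ]
    change algebraMap _ (Localization.Away f) (MvPolynomial.pderiv i f) * _ * _ = _
    ring
  have hmem : MvPolynomial.pderiv i f * g ∈
      MvPolynomial.restrictDegree (Fin n) ℂ ((f.totalDegree + 1) * (v + 1)) := by
    refine restrictDegree_mono ?_ (mul_mem_restrictDegree
      (pderiv_mem_restrictDegree (mem_restrictDegree_totalDegree f) i) hg)
    rw [mul_add]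
    omega
  have hmem' : f * MvPolynomial.pderiv i g ∈
      MvPolynomial.restrictDegree (Fin n) ℂ ((f.totalDegree + 1) * (v + 1)) := by
    refine restrictDegree_mono ?_ (mul_mem_restrictDegree
      (mem_restrictDegree_totalDegree f) (pderiv_mem_restrictDegree hg i))
    rw [mul_add]
    omega
  rw [hact]
  exact add_mem (fracMap_mem f (add_mem hmem' (Submodule.smul_mem _ _ hmem)))
    (Submodule.smul_mem _ _ (fracMap_mem f hmem))

theorem exists_pow_mem_genFil (k : ℕ) :
    ∃ v, toGen f (C (algebraMap _ (Localization.Away f) f ^ k)) ∈ genFil f v := by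
  -- Written over `f^v`, the numerator `f^v f^k` has degree at most `v deg f + deg f^k`, which is
  -- within `(deg f + 1) v` once `v ≥ deg f^k`.
  refine ⟨(f ^ k).totalDegree, ?_⟩
  have h1 : toGen f (C (algebraMap _ (Localization.Away f) f ^ k)) = fracMap f 0 (f ^ k) := by
    change _ = toGen f (C _)
    rw [RingHom.map_pow (algebraMap (MvPolynomial (Fin n) ℂ) _), pow_zero, mul_one]
  have h2 : ∀ v, fracMap f v (f ^ v * f ^ k) = fracMap f 0 (f ^ k) := by
    intro v
    induction v with
    | zero => rw [pow_zero, one_mul]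
    | succ v ih => rw [pow_succ', mul_assoc, fracMap_mul_self, ih]
  rw [h1, ← h2 (f ^ k).totalDegree]
  refine fracMap_mem f (restrictDegree_mono ?_ (mul_mem_restrictDegree
    (mem_restrictDegree_totalDegree _) (mem_restrictDegree_totalDegree _)))
  have h3 := MvPolynomial.totalDegree_pow f (f ^ k).totalDegree
  rw [add_mul, one_mul, mul_comm f.totalDegree]
  omega

/-- **Bernstein's theorem**: a polynomial satisfies a nontrivial functional equation.
For `f = 0` this holds because the module is zero. -/
theorem exists_functionalEq : ∃ b : ℂ[X], b ≠ 0 ∧ FunctionalEq n f b := by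
  have hfin := fun v => finrank_span_image_le (K := FractionRing ℂ[X]) (fracMap f v)
    (MvPolynomial.restrictDegree (Fin n) ℂ ((f.totalDegree + 1) * v))
  have (v : ℕ) : FiniteDimensional (FractionRing ℂ[X]) (genFil f v) := (hfin v).1
  have : CharZero (FractionRing ℂ[X]) :=
    charZero_of_injective_algebraMap (IsFractionRing.injective ℂ[X] (FractionRing ℂ[X]))
  obtain ⟨k, hk⟩ := (weylAction_genOp f).exists_mem_of_chain (genFil f) (genFil_monotone f)
    (fun i v g hg => genOp_X_mem_genFil f i v hg) (fun i v g hg => genOp_del_mem_genFil f i v hg)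
    (Nat.succ_pos f.totalDegree)
    (fun v => (hfin v).2.trans_eq (by rw [finrank_restrictDegree, Fintype.card_fin]))
    (genChain n f) (genChain_antitone f) (fun i k g hg => genOp_mem_genChain f _ k hg)
    (fun i k g hg => genOp_mem_genChain f _ k hg)
    (fun k => toGen f (C (algebraMap _ (Localization.Away f) f ^ k)))
    (toGen_mem_genChain f) (exists_pow_mem_genFil f)
  obtain ⟨b, hb, P, hP⟩ := exists_act_pow_succ f hk
  refine ⟨_, ?_, functionalEq_of_act_pow_succ f hP⟩
  -- The shifted polynomial stays nonzero because `s - k` is not constant.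
  rw [Ne, comp_eq_zero_iff]
  rintro (h | ⟨-, h⟩)
  · exact hb h
  · have h1 := congrArg natDegree h
    rw [natDegree_X_sub_C, natDegree_C] at h1
    exact one_ne_zero h1

end Existence

/-! ### Root multiplicities and the varieties `V_{α,i}`. -/

noncomputable section Stratification

open Polynomial

section

variable {n : ℕ} {A : Type} [CommRing A] [Algebra ℂ A] [Partials n A] (f : A)

theorem mem_of_add_mem {J : Ideal (Weyl n A)[X]} {P Q : (Weyl n A)[X]} (h : P + Q ∈ J)
    (hQ : Q ∈ J) : P ∈ J := by
  have h1 : P + Q + coefS n A (-1) * Q = P := by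
    rw [add_assoc, ← one_add_mul, ← map_one (coefS n A), ← map_add, add_neg_cancel, map_zero,
      zero_mul, add_zero]
  rw [← h1]
  exact add_mem h (Ideal.mul_mem_left _ _ hQ)

theorem coefS_mem_stratIdeal {α : ℂ} {i : ℕ} {h : A} :
    coefS n A h ∈ stratIdeal n f α i ↔
      ∃ P, (coefS n A h + P * sAdd n A α) * sAdd n A α ^ i ∈ bIdeal n f := by
  have hcancel : ∀ P : (Weyl n A)[X], P + coefS n A (-1) * P = 0 := fun P => by
    rw [← one_add_mul, ← map_one (coefS n A), ← map_add, add_neg_cancel, map_zero, zero_mul]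
  rw [stratIdeal, Submodule.mem_sup]
  constructor
  · rintro ⟨P, hP, _, hQ, h1⟩
    obtain ⟨Q, rfl⟩ := Ideal.mem_span_singleton'.1 hQ
    refine ⟨coefS n A (-1) * Q, ?_⟩
    rw [← h1, add_assoc, mul_assoc, hcancel, add_zero]
    exact hP
  · rintro ⟨P, hP⟩
    refine ⟨coefS n A h + P * sAdd n A α, hP, coefS n A (-1) * P * sAdd n A α,
      Ideal.mem_span_singleton'.2 ⟨_, rfl⟩, ?_⟩
    rw [add_assoc, mul_assoc, hcancel, add_zero]

theorem locMapS_sAdd (S : Submonoid A) (α : ℂ) :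
    locMapS n S (sAdd n A α) = sAdd n (Localization S) α := by
  rw [sAdd_eq, sAdd_eq, locMapS_scalarS]

variable {f}

theorem FunctionalEq.localization (S : Submonoid A) {b : ℂ[X]} (hb : FunctionalEq n f b) :
    FunctionalEq n (algebraMap A (Localization S) f) b := by
  rw [functionalEq_iff] at hb ⊢
  rw [← locMapS_scalarS]
  exact locMapS_mem_bIdeal S f hb

/-- After localization `h` is invertible. If `b = c (s+α)^(i+1)`, multiplying the relation for `h`
by `c h⁻¹` puts `c (s+α)^i` into the local ideal modulo a multiple of `b`, against minimality of
`b`. -/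
theorem rootMultiplicity_le_of_coefS_mem {S : Submonoid A} {b : ℂ[X]}
    (hb : IsBFunction n (algebraMap A (Localization S) f) b) {α : ℂ} {i : ℕ} {h : A} (hh : h ∈ S)
    (hmem : coefS n A h ∈ stratIdeal n f α i) : b.rootMultiplicity (-α) ≤ i := by
  obtain ⟨P, hP⟩ := (coefS_mem_stratIdeal f).1 hmem
  have hP' := locMapS_mem_bIdeal S f hP
  rw [RingHom.map_mul, RingHom.map_add, RingHom.map_mul, RingHom.map_pow, locMapS_sAdd,
    locMapS_coefS, sAdd_eq] at hP'
  obtain ⟨u, hu⟩ := (IsLocalization.map_units (Localization S) (⟨h, hh⟩ : S)).exists_left_inv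
  by_contra! hlt
  obtain ⟨c, hc⟩ := (le_rootMultiplicity_iff hb.1.ne_zero).1 (Nat.succ_le_of_lt hlt)
  rw [C_neg, sub_neg_eq_add] at hc
  have hbmem : scalarS n (Localization S) b ∈ bIdeal n (algebraMap A (Localization S) f) :=
    (functionalEq_iff _).1 hb.2.1
  have hcmem : FunctionalEq n (algebraMap A (Localization S) f) (c * (X + C α) ^ i) := by
    rw [functionalEq_iff]
    have h1 := Ideal.mul_mem_left _ (scalarS n (Localization S) c * coefS n (Localization S) u) hP'
    -- The multiplied relation equals `c (s+α)^i + u P b`, where `u = h⁻¹`, since `c` commutes with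
    -- `u P`.
    refine mem_of_add_mem (Q := coefS n (Localization S) u * locMapS n S P *
      scalarS n (Localization S) b) ?_ (Ideal.mul_mem_left _ _ hbmem)
    convert h1 using 1
    have h2 : coefS n (Localization S) u * coefS n (Localization S) (algebraMap A _ h) = 1 := by
      rw [← RingHom.map_mul, hu, map_one]
    have h3 := (scalarS_comm c (coefS n (Localization S) u * locMapS n S P)).eq
    rw [hc, mul_comm ((X + C α) ^ (i + 1)), pow_succ']
    simp only [RingHom.map_mul, RingHom.map_pow]
    rw [← mul_assoc, ← mul_assoc, ← mul_assoc (_ * _) (_ + _), mul_assoc _ _ (_ + _), mul_add, h2,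
      mul_add, mul_one, add_mul, ← mul_assoc _ (locMapS n S P), ← mul_assoc, h3]
  have hdvd := hb.functionalEq_iff_dvd.1 hcmem
  have hc0 : c ≠ 0 := by
    rintro rfl
    exact hb.1.ne_zero (by rw [hc, mul_zero])
  have hX : (X + C α : ℂ[X]).Monic := monic_X_add_C α
  have hne : c * (X + C α) ^ i ≠ 0 := mul_ne_zero hc0 (hX.pow i).ne_zero
  have hdeg := natDegree_le_of_dvd hdvd hne
  rw [hc, mul_comm, natDegree_mul hc0 (hX.pow _).ne_zero, natDegree_mul hc0 (hX.pow _).ne_zero,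
    hX.natDegree_pow, hX.natDegree_pow, natDegree_X_add_C] at hdeg
  omega

/-- Write `b = (s+α)^m c` with `c(-α) ≠ 0`. Then `c / c(-α) = 1 + q' (s+α)`, and for `i ≥ m` the
product of this with `(s+α)^i` is a multiple of `b`. A denominator `h` bringing it into the global
ideal then lies in `I_{α,i}`. -/
theorem exists_coefS_mem_of_rootMultiplicity_le {S : Submonoid A} (hS : S ≤ nonZeroDivisors A)
    {b : ℂ[X]} (hb : IsBFunction n (algebraMap A (Localization S) f) b) {α : ℂ} {i : ℕ}
    (hi : b.rootMultiplicity (-α) ≤ i) : ∃ h ∈ S, coefS n A h ∈ stratIdeal n f α i := by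
  obtain ⟨c, hc, hndvd⟩ := exists_eq_pow_rootMultiplicity_mul_and_not_dvd b hb.1.ne_zero (-α)
  rw [dvd_iff_isRoot, IsRoot] at hndvd
  obtain ⟨q, hq⟩ := X_sub_C_dvd_sub_C_eval (a := -α) (p := c)
  rw [C_neg, sub_neg_eq_add] at hc hq
  have hmem : FunctionalEq n (algebraMap A (Localization S) f)
      ((1 + C (c.eval (-α))⁻¹ * q * (X + C α)) * (X + C α) ^ i) := by
    apply hb.functionalEq_iff_dvd.2
    have h1 : 1 + C (c.eval (-α))⁻¹ * q * (X + C α) = C (c.eval (-α))⁻¹ * c := by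
      have h2 : (C (c.eval (-α))⁻¹ * C (c.eval (-α)) : ℂ[X]) = 1 := by
        rw [← C_mul, inv_mul_cancel₀ hndvd, C_1]
      generalize (C (c.eval (-α))⁻¹ : ℂ[X]) = k at h2 ⊢
      linear_combination (-k) * hq - h2
    rw [h1]
    exact (dvd_of_eq hc).trans ((mul_dvd_mul (pow_dvd_pow _ hi) (dvd_mul_left c _)).trans
      (dvd_of_eq (mul_comm _ _)))
  rw [functionalEq_iff, ← locMapS_scalarS] at hmem
  obtain ⟨h, hh, hmem⟩ := exists_coefS_mul_mem_bIdeal S f hS hmem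
  refine ⟨h, hh, (coefS_mem_stratIdeal f).2
    ⟨coefS n A h * scalarS n A (C (c.eval (-α))⁻¹ * q), ?_⟩⟩
  rw [sAdd_eq]
  convert hmem using 1
  have h1 : scalarS n A ((1 + C (c.eval (-α))⁻¹ * q * (X + C α)) * (X + C α) ^ i) =
      (1 + scalarS n A (C (c.eval (-α))⁻¹ * q) * scalarS n A (X + C α)) *
        scalarS n A (X + C α) ^ i := by
    simp only [map_mul, map_add, map_one, map_pow]
  rw [h1, mul_assoc (coefS n A h) (scalarS n A _), ← mul_one_add, mul_assoc]

end

variable {n : ℕ} {f : MvPolynomial (Fin n) ℂ}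

theorem primeCompl_le_nonZeroDivisors (p : Fin n → ℂ) :
    (maxIdeal p).primeCompl ≤ nonZeroDivisors (MvPolynomial (Fin n) ℂ) :=
  Ideal.primeCompl_le_nonZeroDivisors _

theorem isBFunction_globalB (f : MvPolynomial (Fin n) ℂ) : IsBFunction n f (globalB f) := by
  obtain ⟨b, hb0, hb⟩ := exists_functionalEq f
  exact isBFunction_bFunction hb0 hb

theorem isBFunction_localB (f : MvPolynomial (Fin n) ℂ) (p : Fin n → ℂ) :
    IsBFunction n (algebraMap _ (LocalRingAt p) f) (localB f p) := by
  obtain ⟨b, hb0, hb⟩ := exists_functionalEq f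
  exact isBFunction_bFunction hb0 (hb.localization _)

theorem localB_dvd_globalB (f : MvPolynomial (Fin n) ℂ) (p : Fin n → ℂ) :
    localB f p ∣ globalB f :=
  (isBFunction_localB f p).functionalEq_iff_dvd.1 ((isBFunction_globalB f).2.1.localization _)

theorem localMult_le_globalMult (f : MvPolynomial (Fin n) ℂ) (α : ℂ) (p : Fin n → ℂ) :
    localMult f α p ≤ globalMult f α :=
  rootMultiplicity_le_rootMultiplicity_of_dvd (isBFunction_globalB f).1.ne_zero
    (localB_dvd_globalB f p) _

/-- A point is off the variety iff some polynomial of the ideal does not vanish there, that is, lies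
in the multiplicative set defining the local ring; the two preceding bounds apply to it. -/
theorem mem_stratVar_iff (f : MvPolynomial (Fin n) ℂ) (α : ℂ) (i : ℕ) (p : Fin n → ℂ) :
    p ∈ stratVar f α i ↔ i < localMult f α p := by
  rw [← not_iff_not, not_lt]
  have h1 : p ∉ stratVar f α i ↔ ∃ h ∈ (maxIdeal p).primeCompl,
      coefS n (MvPolynomial (Fin n) ℂ) h ∈ stratIdeal n f α i := by
    rw [stratVar, MvPolynomial.mem_zeroLocus_iff]
    push Not
    refine exists_congr fun h => ?_
    rw [and_comm]
    rfl
  rw [h1]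
  exact ⟨fun ⟨h, hh, hmem⟩ => rootMultiplicity_le_of_coefS_mem (isBFunction_localB f p) hh hmem,
    exists_coefS_mem_of_rootMultiplicity_le (primeCompl_le_nonZeroDivisors p)
      (isBFunction_localB f p)⟩

/-- Both polynomials are monic and split over `ℂ`, so they are determined by their multisets of
roots. -/
theorem localB_eq_iff (f : MvPolynomial (Fin n) ℂ) (p q : Fin n → ℂ) :
    localB f p = localB f q ↔ ∀ α, localMult f α p = localMult f α q := by
  refine ⟨fun h α => by rw [localMult, localMult, h], fun h => ?_⟩
  have hroots : (localB f p).roots = (localB f q).roots := by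
    ext β
    rw [count_roots, count_roots]
    simpa [localMult] using h (-β)
  rw [(IsAlgClosed.splits (localB f p)).eq_prod_roots_of_monic (isBFunction_localB f p).1,
    (IsAlgClosed.splits (localB f q)).eq_prod_roots_of_monic (isBFunction_localB f q).1, hroots]

end Stratification

end BernsteinSato

theorem theorem2p13 (n : ℕ) (f : MvPolynomial (Fin n) ℂ) (hf : f ≠ 0) :
    -- the global and the local `b`-functions exist
    BernsteinSato.IsBFunction n f (BernsteinSato.globalB f) ∧
    (∀ p : Fin n → ℂ, BernsteinSato.IsBFunction n
      (algebraMap _ (BernsteinSato.LocalRingAt p) f) (BernsteinSato.localB f p)) ∧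
    -- `m_α(p) > i` if and only if `p ∈ V(I_{α,i} ∩ ℂ[x])`
    (∀ (α : ℂ) (i : ℕ) (p : Fin n → ℂ),
      BernsteinSato.localMult f α p > i ↔ p ∈ BernsteinSato.stratVar f α i) ∧
    -- for each `α`, the stratification `∅ = V_{α,m_α} ⊆ ⋯ ⊆ V_{α,0} ⊆ ℂⁿ`
    (∀ α : ℂ, BernsteinSato.stratVar f α (BernsteinSato.globalMult f α) = ∅) ∧
    (∀ (α : ℂ) (i : ℕ),
      BernsteinSato.stratVar f α (i + 1) ⊆ BernsteinSato.stratVar f α i) ∧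
    (∀ (α : ℂ) (p : Fin n → ℂ),
      BernsteinSato.localMult f α p = 0 ↔ p ∈ Set.univ \ BernsteinSato.stratVar f α 0) ∧
    (∀ (α : ℂ) (i : ℕ) (p : Fin n → ℂ), BernsteinSato.localMult f α p = i + 1 ↔
      p ∈ BernsteinSato.stratVar f α i \ BernsteinSato.stratVar f α (i + 1)) ∧
    -- the finitely many `V_{α,i}` together stratify `ℂⁿ` by the local `b`-function
    (∀ p q : Fin n → ℂ, BernsteinSato.localB f p = BernsteinSato.localB f q ↔
      ∀ α : ℂ, (BernsteinSato.globalB f).IsRoot (-α) →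
        ∀ i < BernsteinSato.globalMult f α,
          (p ∈ BernsteinSato.stratVar f α i ↔ q ∈ BernsteinSato.stratVar f α i)) := by
  open BernsteinSato in
  refine ⟨isBFunction_globalB f, isBFunction_localB f, fun α i p => (mem_stratVar_iff f α i p).symm,
    fun α => ?_, fun α i p hp => ?_, fun α p => ?_, fun α i p => ?_, fun p q => ?_⟩
  · rw [Set.eq_empty_iff_forall_notMem]
    intro p hp
    exact absurd ((mem_stratVar_iff f α _ p).1 hp) (not_lt.2 (localMult_le_globalMult f α p))
  · rw [mem_stratVar_iff] at hp ⊢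
    omega
  · rw [Set.mem_sdiff, mem_stratVar_iff]
    simp
  · rw [Set.mem_sdiff, mem_stratVar_iff, mem_stratVar_iff]
    omega
  · simp only [mem_stratVar_iff]
    rw [localB_eq_iff]
    refine ⟨fun h α _ i _ => by rw [h], fun h α => ?_⟩
    have hp := localMult_le_globalMult f α p
    have hq := localMult_le_globalMult f α q
    by_cases h0 : globalMult f α = 0
    · omega
    have hroot : (globalB f).IsRoot (-α) :=
      (Polynomial.rootMultiplicity_pos (isBFunction_globalB f).1.ne_zero).1 (Nat.pos_of_ne_zero h0)
    -- If the multiplicities differ, take `i` to be the smaller one: exactly one of the two points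
    -- lies in `V_{α,i}`, and `i < m_α` because the larger one is at most `m_α`.
    rcases lt_trichotomy (localMult f α p) (localMult f α q) with hlt | heq | hlt
    · exact absurd ((h α hroot _ (hlt.trans_le hq)).2 hlt) (lt_irrefl _)
    · exact heq
    · exact absurd ((h α hroot _ (hlt.trans_le hp)).1 hlt) (lt_irrefl _)
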